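/- Let $p,q\in\mathbb C$ with $|p|<1$ and $q\neq 0$. For $x\in\mathbb C\setminus\{0\}$ put $$\theta(x)=\prod_{j=0}^\infty(1-p^jx)(1-p^{j+1}/x),\qquad (x)_k=\prod_{i=0}^{k-1}\theta(xq^i)\quad(k\in\mathbb Z_{\geq 0}),$$ and for $z=(z_1,\dots,z_n)$ with nonzero entries put $\Delta(z)=\prod_{1\leq j<k\leq n}z_j\,\theta(z_k/z_j)$ and $zq^y=(z_1q^{y_1},\dots,z_nq^{y_n})$. Let $n,m,N$ be integers with $0\leq m\leq n$ and $N\geq 0$, and let $z_1,\dots,z_n,a_1,\dots,a_{n+2},w_1,w_2$ be nonzero complex numbers such that $$w_1w_2=z_1\cdots z_n\,a_1\cdots a_{n+2}.$$ Define $$x=(q^{1-N}a_1/w_1w_2,\dots,q^{1-N}a_{n-m}/w_1w_2,\,z_{n-m+1},\dots,z_n),$$ $$b=(q^{N-1}w_1w_2z_1,\dots,q^{N-1}w_1w_2z_{n-m},\,a_{n-m+1},\dots,a_{n+2}).$$ Assume that the parameters are such that no denominator vanishes in the two sums below, that is, for $u=z$ and for $u=x$ one has $\Delta(u)\neq 0$,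 $(w_ju_k)_N\neq 0$ for $1\leq k\leq n$, $j=1,2$, and $(qu_k/u_j)_N\neq 0$ for $1\leq j,k\leq n$. Then $$\sum_{\substack{y_1,\dots,y_n\geq 0\\y_1+\dots+y_n=N}}\frac{\Delta(zq^y)}{\Delta(z)}\prod_{k=1}^n\frac{\prod_{j=1}^{n+2}(a_jz_k)_{y_k}}{\prod_{j=1}^2(w_jz_k)_{y_k}\prod_{j=1}^n(qz_k/z_j)_{y_k}}$$ $$=\prod_{j=1}^{n-m}\frac{(a_jz_j)^N(w_1/a_j)_N(w_2/a_j)_N}{(w_1z_j)_N(w_2z_j)_N}\sum_{\substack{y_1,\dots,y_n\geq 0\\y_1+\dots+y_n=N}}\frac{\Delta(xq^y)}{\Delta(x)}\prod_{k=1}^n\frac{\prod_{j=1}^{n+2}(b_jx_k)_{y_k}}{\prod_{j=1}^2(w_jx_k)_{y_k}\prod_{j=1}^n(qx_k/x_j)_{y_k}}.$$ Here $(a_jz_j)^N$ is an ordinary power, and the case $p=0$ is included. -/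

import Mathlib

open scoped BigOperators

noncomputable section

namespace EllipticHyp

/-- The theta function `θ(x) = ∏_{j ≥ 0} (1 - p^j x)(1 - p^(j+1) / x)` of nome `p`
(used for `|p| < 1` and `x ≠ 0`, where the product converges absolutely, see
`multipliable_theta`; for `p = 0` it is `1 - x`). -/
def theta (p x : ℂ) : ℂ :=
  ∏' j : ℕ, (1 - p ^ j * x) * (1 - p ^ (j + 1) / x)

/-- The infinite product defining `theta` converges. -/
theorem multipliable_theta {p : ℂ} (hp : ‖p‖ < 1) (x : ℂ) :
    Multipliable (fun j : ℕ => (1 - p ^ j * x) * (1 - p ^ (j + 1) / x)) := by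
  have hs : Summable (fun j : ℕ => ‖p‖ ^ j) := summable_geometric_of_lt_one (norm_nonneg p) hp
  apply Multipliable.mul
  · have h : Summable (fun j : ℕ => ‖-(p ^ j * x)‖) := by
      simpa [norm_mul, norm_pow] using hs.mul_right ‖x‖
    simpa [sub_eq_add_neg] using multipliable_one_add_of_summable h
  · have h : Summable (fun j : ℕ => ‖-(p ^ (j + 1) / x)‖) := by
      simpa [norm_div, norm_pow, pow_succ, div_eq_mul_inv, mul_assoc] using
        hs.mul_right (‖p‖ * ‖x‖⁻¹)
    simpa [sub_eq_add_neg] using multipliable_one_add_of_summable h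

/-- The elliptic Pochhammer symbol `(a)_k = θ(a) θ(aq) ⋯ θ(aq^(k-1))`. -/
def poch (p q a : ℂ) (k : ℕ) : ℂ :=
  ∏ i ∈ Finset.range k, theta p (a * q ^ i)

/-- The elliptic Weyl denominator `Δ(z) = ∏_{j < k} z_j θ(z_k / z_j)`. -/
def Delta (p : ℂ) {n : ℕ} (z : Fin n → ℂ) : ℂ :=
  ∏ j : Fin n, ∏ k ∈ Finset.Ioi j, z j * theta p (z k / z j)

/-- The `A_n` elliptic hypergeometric sum
`∑_{y_1 + ⋯ + y_n = N} Δ(z q^y) / Δ(z) *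
  ∏_k (∏_j (a_j z_k)_{y_k}) / (∏_j (w_j z_k)_{y_k} * ∏_j (q z_k / z_j)_{y_k})`,
over all `n`-tuples `y` of nonnegative integers with sum `N`. -/
def ellSum (p q : ℂ) (N : ℕ) {n l m : ℕ}
    (z : Fin n → ℂ) (a : Fin l → ℂ) (w : Fin m → ℂ) : ℂ :=
  ∑ y ∈ Finset.piAntidiag (Finset.univ : Finset (Fin n)) N,
    Delta p (fun k => z k * q ^ y k) / Delta p z *
      ∏ k : Fin n,
        (∏ j : Fin l, poch p q (a j * z k) (y k)) /
          ((∏ j : Fin m, poch p q (w j * z k) (y k)) *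
            ∏ j : Fin n, poch p q (q * z k / z j) (y k))

/-- No denominator occurring in the terms of `ellSum p q N z a w` vanishes.  Every
`0 ≤ y_k ≤ N` occurs in the sum and `(c)_{y}` divides `(c)_N` for `y ≤ N`, so it is enough
to look at the index `N`. -/
def Admissible (p q : ℂ) (N : ℕ) {n m : ℕ} (z : Fin n → ℂ) (w : Fin m → ℂ) : Prop :=
  Delta p z ≠ 0 ∧
  (∀ k : Fin n, ∀ j : Fin m, poch p q (w j * z k) N ≠ 0) ∧
  (∀ k j : Fin n, poch p q (q * z k / z j) N ≠ 0)

/-- `x = (q^(1-N) a_1 / (w₁ w₂), …, q^(1-N) a_(n-m) / (w₁ w₂), z_(n-m+1), …, z_n)`. -/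
def xParam (q : ℂ) (N : ℕ) {n : ℕ} (m : ℕ) (z : Fin n → ℂ) (a : Fin (n + 2) → ℂ)
    (w₁ w₂ : ℂ) : Fin n → ℂ :=
  fun j => if (j : ℕ) < n - m then q ^ (1 - (N : ℤ)) * a (Fin.castAdd 2 j) / (w₁ * w₂) else z j

/-- `b = (q^(N-1) w₁ w₂ z_1, …, q^(N-1) w₁ w₂ z_(n-m), a_(n-m+1), …, a_(n+2))`. -/
def bParam (q : ℂ) (N : ℕ) {n : ℕ} (m : ℕ) (z : Fin n → ℂ) (a : Fin (n + 2) → ℂ)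
    (w₁ w₂ : ℂ) : Fin (n + 2) → ℂ :=
  fun j => if h : (j : ℕ) < n - m then
    q ^ ((N : ℤ) - 1) * w₁ * w₂ * z ⟨j, lt_of_lt_of_le h (Nat.sub_le n m)⟩ else a j

end EllipticHyp

end

/-! The engine is a duality. If `l = n + m` and `∏ w = ∏ z · ∏ a`, the `A_n` sum with nodes `z`,
numerator parameters `a` and denominator parameters `w` equals the `A_m` sum with nodes `w`,
numerators `1/a` and denominators `z` (`DualGeneric.ellSum_eq`). With two denominator parameters the
dual sum runs over `y_0 + y_1 = N`, and for `j ≤ n` the pair `(z_j, a_j)` enters only through the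
ratio `∏_k (w_k/a_j)_{y_k} / (w_k z_j)_{y_k}`. Reversing the order of the factors (`poch_reverse`)
shows that replacing `(z_j, a_j)` by `(q^(1-N) a_j/(w₁w₂), q^(N-1) w₁w₂ z_j)` changes this ratio
only by a factor independent of `y` (`poch_swap`), namely the `j`-th factor of the prefactor. The
replacement preserves `z_j a_j`, hence the balancing, so both sides can be dualised and compared
term by term (`ellSum_swap_of_generic`).

The duality is proved by induction on `N`. The recursion `ellSum_succ` lowers `N` by one while
sending `z_k` to `z_k q` and one fixed `a_i` to `a_i/q`. Applying it on one side, dualising by the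
induction hypothesis and applying it again gives a double sum over `(k, r)` in which `a_i` is
restored; the result is symmetric under duality (`recCoeff_update_mul`). The case `N = 1`, like the
recursion itself, is an instance of the type `A` partial fraction identity
`sum_prod_theta_div_eq_zero`. That identity follows by induction from a three-term relation, that
is, from the addition formula `exists_theta_mul_theta_eq`, which comes from the Jacobi triple
product.

These arguments divide by many theta values, so they need generic parameters. The parameters are
therefore deformed along curves `c e^(rt)` that preserve the balancing. Almost every `t` is generic
because theta has countably many zeros, and continuity at `t = 0` requires only admissibility. -/

noncomputable section

namespace EllipticHyp

/-! ### Zeros, inversion and continuity of the theta function -/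

section

open Filter Topology Finset

/-- The infinite product `∏_{j ≥ 0} (1 - p^j x)`. -/
def eulerProd (p x : ℂ) : ℂ := ∏' j : ℕ, (1 + -(p ^ j * x))

theorem summable_norm_neg_pow_mul {p : ℂ} (hp : ‖p‖ < 1) (x : ℂ) :
    Summable (fun j : ℕ => ‖-(p ^ j * x)‖) := by
  simpa [norm_mul, norm_pow] using
    (summable_geometric_of_lt_one (norm_nonneg p) hp).mul_right ‖x‖

theorem multipliable_eulerProd {p : ℂ} (hp : ‖p‖ < 1) (x : ℂ) :
    Multipliable (fun j : ℕ => 1 + -(p ^ j * x)) :=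
  multipliable_one_add_of_summable (summable_norm_neg_pow_mul hp x)

theorem eulerProd_eq {p : ℂ} (hp : ‖p‖ < 1) (x : ℂ) :
    eulerProd p x = (1 - x) * eulerProd p (p * x) := by
  have he : (fun j : ℕ => 1 + -(p ^ (j + 1) * x)) = fun j : ℕ => 1 + -(p ^ j * (p * x)) := by
    funext j
    ring
  have h : Multipliable (fun j : ℕ => 1 + -(p ^ (j + 1) * x)) :=
    he ▸ multipliable_eulerProd hp (p * x)
  have key := tprod_eq_zero_mul' (f := fun j : ℕ => 1 + -(p ^ j * x)) h
  rw [he] at key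
  rw [eulerProd, eulerProd, key, pow_zero, one_mul, sub_eq_add_neg]

theorem exists_pow_mul_eq_one_of_eulerProd_eq_zero {p : ℂ} (hp : ‖p‖ < 1) {x : ℂ}
    (h : eulerProd p x = 0) : ∃ j : ℕ, p ^ j * x = 1 := by
  by_contra! hne
  refine tprod_one_add_ne_zero_of_summable (f := fun j : ℕ => -(p ^ j * x)) (fun j hj => ?_)
    (summable_norm_neg_pow_mul hp x) h
  exact hne j (by linear_combination -hj)

theorem eulerProd_eq_zero {p : ℂ} {x : ℂ} {j : ℕ} (h : p ^ j * x = 1) : eulerProd p x = 0 :=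
  tprod_of_exists_eq_zero ⟨j, by rw [h]; ring⟩

theorem continuous_eulerProd {p : ℂ} (hp : ‖p‖ < 1) : Continuous (eulerProd p) := by
  rw [continuous_iff_continuousAt]
  intro x
  have hs : Summable (fun j : ℕ => ‖p‖ ^ j * (‖x‖ + 1)) :=
    (summable_geometric_of_lt_one (norm_nonneg p) hp).mul_right _
  have h := Summable.hasProdLocallyUniformlyOn_nat_one_add
    (f := fun (j : ℕ) (y : ℂ) => -(p ^ j * y)) (K := Metric.ball 0 (‖x‖ + 1)) Metric.isOpen_ball hs
    (Eventually.of_forall fun j y hy => by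
      rw [norm_neg, norm_mul, norm_pow]
      have : ‖y‖ < ‖x‖ + 1 := by simpa using hy
      gcongr)
    (fun j => by fun_prop)
  have hc : ContinuousOn (eulerProd p) (Metric.ball 0 (‖x‖ + 1)) :=
    h.tendstoLocallyUniformlyOn_finsetRange.continuousOn
      (Eventually.of_forall fun N => by fun_prop).frequently
  exact hc.continuousAt (Metric.isOpen_ball.mem_nhds (by simp))

theorem theta_eq_eulerProd {p : ℂ} (hp : ‖p‖ < 1) (x : ℂ) :
    theta p x = eulerProd p x * eulerProd p (p / x) := by
  rw [eulerProd, eulerProd, ← (multipliable_eulerProd hp x).tprod_mul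
    (multipliable_eulerProd hp (p / x)), theta]
  refine tprod_congr fun j => ?_
  rw [pow_succ]; ring

theorem continuousAt_theta {p : ℂ} (hp : ‖p‖ < 1) {x : ℂ} (hx : x ≠ 0) :
    ContinuousAt (theta p) x := by
  rw [show theta p = fun x => eulerProd p x * eulerProd p (p / x) from
    funext (theta_eq_eulerProd hp)]
  have h := continuous_eulerProd hp
  exact h.continuousAt.mul
    (ContinuousAt.comp (f := fun x => p / x) h.continuousAt
      (continuousAt_const.div continuousAt_id hx))

theorem theta_one (p : ℂ) : theta p 1 = 0 :=
  tprod_of_exists_eq_zero ⟨0, by simp⟩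

theorem theta_inv {p : ℂ} (hp : ‖p‖ < 1) {x : ℂ} (hx : x ≠ 0) :
    theta p x⁻¹ = -x⁻¹ * theta p x := by
  rw [theta_eq_eulerProd hp, theta_eq_eulerProd hp, eulerProd_eq hp x⁻¹, eulerProd_eq hp x,
    div_eq_mul_inv, inv_inv, div_eq_mul_inv]
  field_simp
  ring

theorem theta_div_comm {p : ℂ} (hp : ‖p‖ < 1) {x y : ℂ} (hx : x ≠ 0) (hy : y ≠ 0) :
    theta p (x / y) = -(x / y) * theta p (y / x) := by
  have := theta_inv hp (div_ne_zero hy hx)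
  rwa [inv_div] at this

/-- The zeros of the two Euler products are the nonpositive and the positive powers of `p`. When `p
= 0`, only `r = 0` gives a nonzero power, so the single zero is `1`. -/
theorem theta_eq_zero_iff {p : ℂ} (hp : ‖p‖ < 1) {x : ℂ} (hx : x ≠ 0) :
    theta p x = 0 ↔ ∃ r : ℤ, x = p ^ r := by
  rw [theta_eq_eulerProd hp, mul_eq_zero]
  constructor
  · rintro (h | h)
    · obtain ⟨j, hj⟩ := exists_pow_mul_eq_one_of_eulerProd_eq_zero hp h
      refine ⟨-j, ?_⟩
      rw [zpow_neg, zpow_natCast]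
      exact eq_inv_of_mul_eq_one_right hj
    · obtain ⟨j, hj⟩ := exists_pow_mul_eq_one_of_eulerProd_eq_zero hp h
      refine ⟨(j + 1 : ℕ), ?_⟩
      rw [zpow_natCast, pow_succ]
      field_simp at hj
      exact hj.symm
  · rintro ⟨r, rfl⟩
    by_cases hp0 : p = 0
    · subst hp0
      have hr : r = 0 := by
        by_contra hr
        exact hx (zero_zpow r hr)
      subst hr
      exact Or.inl (eulerProd_eq_zero (j := 0) (by simp))
    · obtain ⟨j, rfl | rfl⟩ := r.eq_nat_or_neg
      · cases j with
        | zero => exact Or.inl (eulerProd_eq_zero (j := 0) (by simp))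
        | succ j =>
          refine Or.inr (eulerProd_eq_zero (j := j) ?_)
          rw [zpow_natCast, pow_succ]
          field_simp
      · refine Or.inl (eulerProd_eq_zero (j := j) ?_)
        rw [zpow_neg, zpow_natCast]
        field_simp

/-- The zeros form a multiplicative group, the powers of `p`. -/
theorem theta_div_eq_zero {p : ℂ} (hp : ‖p‖ < 1) {x y : ℂ} (hx : x ≠ 0) (hy : y ≠ 0)
    (h₁ : theta p x = 0) (h₂ : theta p y = 0) : theta p (x / y) = 0 := by
  rw [theta_eq_zero_iff hp (div_ne_zero hx hy)]
  obtain ⟨r, rfl⟩ := (theta_eq_zero_iff hp hx).1 h₁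
  obtain ⟨s, rfl⟩ := (theta_eq_zero_iff hp hy).1 h₂
  by_cases hp0 : p = 0
  · subst hp0
    have hr : r = 0 := by
      by_contra hr
      exact hx (zero_zpow r hr)
    have hs : s = 0 := by
      by_contra hs
      exact hy (zero_zpow s hs)
    exact ⟨0, by simp [hr, hs]⟩
  · exact ⟨r - s, by rw [zpow_sub₀ hp0]⟩

theorem countable_theta_eq_zero {p : ℂ} (hp : ‖p‖ < 1) :
    {x : ℂ | x ≠ 0 ∧ theta p x = 0}.Countable := by
  refine (Set.countable_range (fun r : ℤ => p ^ r)).mono ?_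
  rintro x ⟨hx, h⟩
  obtain ⟨r, rfl⟩ := (theta_eq_zero_iff hp hx).1 h
  exact ⟨r, rfl⟩

/-! ### The Jacobi triple product -/

/-- The `p`-binomial coefficient, defined by the Pascal recurrence. -/
def gaussBinom (p : ℂ) : ℕ → ℕ → ℂ
  | _, 0 => 1
  | 0, _ + 1 => 0
  | n + 1, k + 1 => gaussBinom p n k + p ^ (k + 1) * gaussBinom p n (k + 1)

theorem gaussBinom_zero_right (p : ℂ) (n : ℕ) : gaussBinom p n 0 = 1 := by
  cases n <;> rfl

theorem gaussBinom_eq_zero_of_lt (p : ℂ) : ∀ {n k : ℕ}, n < k → gaussBinom p n k = 0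
  | 0, _ + 1, _ => rfl
  | n + 1, k + 1, h => by
    rw [gaussBinom, gaussBinom_eq_zero_of_lt p (Nat.lt_of_succ_lt_succ h),
      gaussBinom_eq_zero_of_lt p (Nat.lt_of_succ_lt h)]
    simp

/-- The finite product `(p; p)_n`. -/
def qFact (p : ℂ) (n : ℕ) : ℂ := ∏ i ∈ range n, (1 - p ^ (i + 1))

theorem qFact_succ (p : ℂ) (n : ℕ) : qFact p (n + 1) = qFact p n * (1 - p ^ (n + 1)) :=
  prod_range_succ _ _

theorem gaussBinom_mul_qFact (p : ℂ) (k l : ℕ) :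
    gaussBinom p (k + l) k * (qFact p k * qFact p l) = qFact p (k + l) := by
  induction k generalizing l with
  | zero => simp [gaussBinom_zero_right, qFact]
  | succ k ihk =>
    induction l with
    | zero =>
      have h := ihk 0
      rw [add_zero] at h ⊢
      rw [gaussBinom, gaussBinom_eq_zero_of_lt p k.lt_succ_self, qFact_succ]
      linear_combination (1 - p ^ (k + 1)) * h
    | succ l ihl =>
      have h := ihk (l + 1)
      rw [show k + 1 + (l + 1) = (k + (l + 1)) + 1 by ring, gaussBinom,
        show qFact p (k + (l + 1) + 1) = qFact p (k + (l + 1)) * (1 - p ^ (k + (l + 1) + 1)) from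
          qFact_succ _ _]
      rw [show k + 1 + l = k + (l + 1) by ring] at ihl
      rw [qFact_succ p k, qFact_succ p l] at *
      linear_combination (1 - p ^ (k + 1)) * h + p ^ (k + 1) * (1 - p ^ (l + 1)) * ihl

/-- The finite `q`-binomial theorem: splitting off the factor `j = 0` leaves the same product at `p
y`, and Pascal's rule matches coefficients. -/
theorem prod_one_add_pow_mul (p y : ℂ) (n : ℕ) :
    ∏ j ∈ range n, (1 + p ^ j * y) =
      ∑ k ∈ range (n + 1), gaussBinom p n k * p ^ k.choose 2 * y ^ k := by
  induction n generalizing y with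
  | zero => simp [gaussBinom]
  | succ n ih =>
    have h : ∏ j ∈ range n, (1 + p ^ (j + 1) * y) =
        ∑ k ∈ range (n + 1), gaussBinom p n k * p ^ k.choose 2 * (p * y) ^ k := by
      rw [← ih]
      exact prod_congr rfl fun j _ => by ring
    rw [prod_range_succ', h, sum_range_succ' _ (n + 1)]
    have h₁ : ∑ k ∈ range (n + 1), gaussBinom p (n + 1) (k + 1) * p ^ (k + 1).choose 2 * y ^ (k + 1)
        = y * (∑ k ∈ range (n + 1), gaussBinom p n k * p ^ k.choose 2 * (p * y) ^ k) +
          ∑ k ∈ range (n + 1),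
            gaussBinom p n (k + 1) * p ^ (k + 1).choose 2 * (p * y) ^ (k + 1) := by
      rw [mul_sum, ← sum_add_distrib]
      refine sum_congr rfl fun k _ => ?_
      rw [gaussBinom, Nat.choose_succ_succ' k 1, Nat.choose_one_right]
      ring
    have h₂ := sum_range_succ' (fun k => gaussBinom p n k * p ^ k.choose 2 * (p * y) ^ k) (n + 1)
    rw [sum_range_succ, gaussBinom_eq_zero_of_lt p n.lt_succ_self] at h₂
    simp only [gaussBinom_zero_right] at h₂ ⊢
    rw [h₁]
    linear_combination h₂

/-- The general term of the Jacobi series `∑_k (-1)^k p^(k(k-1)/2) x^k`. -/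
def jacobiTerm (p x : ℂ) (k : ℤ) : ℂ := (-1) ^ k * p ^ (k * (k - 1) / 2) * x ^ k

theorem two_mul_half_mul_pred (k : ℤ) : 2 * (k * (k - 1) / 2) = k * (k - 1) :=
  Int.mul_ediv_cancel' (Int.even_mul_pred_self k).two_dvd

theorem half_mul_pred_succ (k : ℤ) : (k + 1) * (k + 1 - 1) / 2 = k * (k - 1) / 2 + k := by
  have h₁ := two_mul_half_mul_pred k
  have h₂ := two_mul_half_mul_pred (k + 1)
  have h₃ : (k + 1) * (k + 1 - 1) = k * (k - 1) + 2 * k := by ring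
  omega

theorem jacobiTerm_ne_zero {p x : ℂ} (hp0 : p ≠ 0) (hx : x ≠ 0) (k : ℤ) :
    jacobiTerm p x k ≠ 0 :=
  mul_ne_zero (mul_ne_zero (zpow_ne_zero _ (by norm_num)) (zpow_ne_zero _ hp0)) (zpow_ne_zero _ hx)

theorem jacobiTerm_succ {p x : ℂ} (hp0 : p ≠ 0) (hx : x ≠ 0) (k : ℤ) :
    jacobiTerm p x (k + 1) = -(p ^ k * x) * jacobiTerm p x k := by
  rw [jacobiTerm, jacobiTerm, half_mul_pred_succ, zpow_add₀ hp0, zpow_add_one₀ hx,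
    zpow_add_one₀ (by norm_num)]
  ring

theorem summable_norm_jacobiTerm {p x : ℂ} (hp : ‖p‖ < 1) (hp0 : p ≠ 0) (hx : x ≠ 0) :
    Summable (fun k => ‖jacobiTerm p x k‖) := by
  have hpow : Tendsto (fun n : ℕ => ‖p‖ ^ n) atTop (𝓝 0) :=
    tendsto_pow_atTop_nhds_zero_of_lt_one (norm_nonneg p) hp
  apply Summable.of_nat_of_neg
  · refine summable_of_ratio_test_tendsto_lt_one zero_lt_one
      (Eventually.of_forall fun n => norm_ne_zero_iff.2 (jacobiTerm_ne_zero hp0 hx _)) ?_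
    have : (fun n : ℕ => ‖‖jacobiTerm p x ((n + 1 : ℕ) : ℤ)‖‖ / ‖‖jacobiTerm p x (n : ℤ)‖‖) =
        fun n : ℕ => ‖p‖ ^ n * ‖x‖ := by
      funext n
      rw [norm_norm, norm_norm, Nat.cast_succ, jacobiTerm_succ hp0 hx, norm_mul, norm_neg,
        norm_mul, zpow_natCast, norm_pow,
        mul_div_cancel_right₀ _ (norm_ne_zero_iff.2 (jacobiTerm_ne_zero hp0 hx _))]
    rw [this]
    simpa using hpow.mul_const ‖x‖
  · refine summable_of_ratio_test_tendsto_lt_one zero_lt_one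
      (Eventually.of_forall fun n => norm_ne_zero_iff.2 (jacobiTerm_ne_zero hp0 hx _)) ?_
    have : (fun n : ℕ => ‖‖jacobiTerm p x (-((n + 1 : ℕ) : ℤ))‖‖ / ‖‖jacobiTerm p x (-(n : ℤ))‖‖) =
        fun n : ℕ => ‖p‖ ^ n * (‖p‖ * ‖x‖⁻¹) := by
      funext n
      have h := jacobiTerm_succ hp0 hx (-((n + 1 : ℕ) : ℤ))
      rw [show -((n + 1 : ℕ) : ℤ) + 1 = -(n : ℤ) by push_cast; ring] at h
      have hne : ‖jacobiTerm p x (-((n + 1 : ℕ) : ℤ))‖ ≠ 0 :=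
        norm_ne_zero_iff.2 (jacobiTerm_ne_zero hp0 hx _)
      have hpn : ‖p‖ ≠ 0 := norm_ne_zero_iff.2 hp0
      have hxn : ‖x‖ ≠ 0 := norm_ne_zero_iff.2 hx
      rw [norm_norm, norm_norm, h, norm_mul, norm_neg, norm_mul, zpow_neg, norm_inv, zpow_natCast,
        norm_pow]
      field_simp
      rw [pow_succ]
    rw [this]
    simpa using hpow.mul_const (‖p‖ * ‖x‖⁻¹)

/-- A finite form of the triple product: the `q`-binomial theorem with `2n` factors, centred by the
substitution `y = -x p^(-n)`. -/
theorem prod_range_theta_factors {p x : ℂ} (hp0 : p ≠ 0) (hx : x ≠ 0) (n : ℕ) :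
    ∏ j ∈ range n, ((1 - p ^ j * x) * (1 - p ^ (j + 1) / x)) =
      ∑ k ∈ range (2 * n + 1), gaussBinom p (2 * n) k * jacobiTerm p x (k - n) := by
  have h := prod_one_add_pow_mul p (-(x * (p ^ n)⁻¹)) (2 * n)
  -- The factors with `i < n` are `1 - p^(i-n) x`. The monomial `jacobiTerm p x (-n)` turns them
  -- into `1 - p^(n-i)/x`.
  have hr : (∏ i ∈ range (2 * n), (1 + p ^ i * -(x * (p ^ n)⁻¹))) * jacobiTerm p x (-n) =
      ∏ j ∈ range n, ((1 - p ^ j * x) * (1 - p ^ (j + 1) / x)) := by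
    clear h
    induction n with
    | zero => simp [jacobiTerm]
    | succ n ih =>
      rw [prod_range_succ, ← ih, show 2 * (n + 1) = 2 * n + 1 + 1 by ring, prod_range_succ,
        prod_range_succ']
      have h₁ : ∏ i ∈ range (2 * n), (1 + p ^ (i + 1) * -(x * (p ^ (n + 1))⁻¹)) =
          ∏ i ∈ range (2 * n), (1 + p ^ i * -(x * (p ^ n)⁻¹)) := by
        refine prod_congr rfl fun i _ => ?_
        field_simp
        ring
      have h₂ := jacobiTerm_succ hp0 hx (-((n + 1 : ℕ) : ℤ))
      rw [show -((n + 1 : ℕ) : ℤ) + 1 = -(n : ℤ) by push_cast; ring, zpow_neg, zpow_natCast] at h₂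
      rw [h₁, h₂]
      field_simp
      ring_nf
  rw [← hr, h, sum_mul]
  refine sum_congr rfl fun k _ => ?_
  have : ∀ k : ℕ, jacobiTerm p x (k - n) =
      p ^ k.choose 2 * (-(x * (p ^ n)⁻¹)) ^ k * jacobiTerm p x (-n) := by
    intro k
    induction k with
    | zero => simp
    | succ k ihk =>
      rw [show ((k + 1 : ℕ) : ℤ) - n = (k - n) + 1 by push_cast; ring, jacobiTerm_succ hp0 hx, ihk,
        Nat.choose_succ_succ' k 1, Nat.choose_one_right, zpow_sub₀ hp0, zpow_natCast, zpow_natCast]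
      ring
  rw [this]
  ring

theorem tendsto_qFact {p : ℂ} (hp : ‖p‖ < 1) :
    Tendsto (qFact p) atTop (𝓝 (eulerProd p p)) := by
  have h := (multipliable_eulerProd hp p).tendsto_prod_tprod_nat
  refine h.congr fun n => prod_congr rfl fun i _ => ?_
  ring

theorem one_sub_pow_succ_ne_zero {p : ℂ} (hp : ‖p‖ < 1) (j : ℕ) : 1 - p ^ (j + 1) ≠ 0 := by
  intro h
  have : ‖p ^ (j + 1)‖ = 1 := by rw [← sub_eq_zero.1 h, norm_one]
  rw [norm_pow] at this
  exact (pow_lt_one₀ (norm_nonneg p) hp j.succ_ne_zero).ne this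

theorem eulerProd_self_ne_zero {p : ℂ} (hp : ‖p‖ < 1) : eulerProd p p ≠ 0 := by
  intro h
  obtain ⟨j, hj⟩ := exists_pow_mul_eq_one_of_eulerProd_eq_zero hp h
  exact one_sub_pow_succ_ne_zero hp j (by rw [pow_succ, hj, sub_self])

theorem qFact_ne_zero {p : ℂ} (hp : ‖p‖ < 1) (n : ℕ) : qFact p n ≠ 0 :=
  prod_ne_zero_iff.2 fun i _ => one_sub_pow_succ_ne_zero hp i

theorem gaussBinom_eq_div {p : ℂ} (hp : ‖p‖ < 1) (k l : ℕ) :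
    gaussBinom p (k + l) k = qFact p (k + l) * (qFact p k)⁻¹ * (qFact p l)⁻¹ := by
  have h₁ := qFact_ne_zero hp k
  have h₂ := qFact_ne_zero hp l
  rw [← gaussBinom_mul_qFact]
  field_simp

/-- A bound uniform in both indices supplies the dominating series when the finite triple product
passes to its limit. -/
theorem norm_gaussBinom_bounded {p : ℂ} (hp : ‖p‖ < 1) :
    ∃ C : ℝ, 0 ≤ C ∧ ∀ n k : ℕ, ‖gaussBinom p n k‖ ≤ C := by
  obtain ⟨C, hC⟩ := (Metric.isBounded_range_of_tendsto _ (tendsto_qFact hp)).exists_norm_le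
  obtain ⟨D, hD⟩ := (Metric.isBounded_range_of_tendsto _
    ((tendsto_qFact hp).inv₀ (eulerProd_self_ne_zero hp))).exists_norm_le
  have hC' : ∀ n, ‖qFact p n‖ ≤ C := fun n => hC _ ⟨n, rfl⟩
  have hD' : ∀ n, ‖(qFact p n)⁻¹‖ ≤ D := fun n => hD _ ⟨n, rfl⟩
  have hC0 : 0 ≤ C := (norm_nonneg _).trans (hC' 0)
  have hD0 : 0 ≤ D := (norm_nonneg _).trans (hD' 0)
  refine ⟨C * D * D, by positivity, fun n k => ?_⟩
  by_cases h : k ≤ n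
  · obtain ⟨l, rfl⟩ := Nat.exists_eq_add_of_le h
    rw [gaussBinom_eq_div hp, norm_mul, norm_mul]
    have h₁ := hC' (k + l)
    have h₂ := hD' k
    have h₃ := hD' l
    gcongr
  · rw [gaussBinom_eq_zero_of_lt p (not_le.1 h), norm_zero]
    positivity

/-- The Jacobi triple product identity. -/
theorem eulerProd_mul_theta {p x : ℂ} (hp : ‖p‖ < 1) (hp0 : p ≠ 0) (hx : x ≠ 0) :
    eulerProd p p * theta p x = ∑' k : ℤ, jacobiTerm p x k := by
  have hP := eulerProd_self_ne_zero hp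
  -- The finite sums are extended by zero to all of `ℤ`. Each coefficient tends to `1/(p;p)_∞`, so
  -- dominated convergence applies.
  let f : ℕ → ℤ → ℂ := fun n m =>
    if m ∈ Icc (-(n : ℤ)) n then gaussBinom p (2 * n) (m + n).toNat * jacobiTerm p x m else 0
  have hf : ∀ n : ℕ, ∏ j ∈ range n, ((1 - p ^ j * x) * (1 - p ^ (j + 1) / x)) = ∑' m, f n m := by
    intro n
    rw [prod_range_theta_factors hp0 hx, tsum_eq_sum (s := Icc (-(n : ℤ)) n)
      (fun m hm => if_neg hm)]
    refine sum_bij' (fun k _ => (k : ℤ) - n) (fun m _ => (m + n).toNat) ?_ ?_ ?_ ?_ ?_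
    · intro k hk
      rw [mem_range] at hk
      rw [mem_Icc]
      omega
    · intro m hm
      rw [mem_Icc] at hm
      rw [mem_range]
      omega
    · intro k _
      simp
    · intro m hm
      rw [mem_Icc] at hm
      omega
    · intro k hk
      rw [mem_range] at hk
      have hm : (k : ℤ) - n ∈ Icc (-(n : ℤ)) n := by
        rw [mem_Icc]
        omega
      simp only [if_pos hm]
      simp
  obtain ⟨C, hC0, hC⟩ := norm_gaussBinom_bounded hp
  have hlim : Tendsto (fun n => ∑' m, f n m) atTop
      (𝓝 (∑' m, (eulerProd p p)⁻¹ * jacobiTerm p x m)) := by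
    refine tendsto_tsum_of_dominated_convergence
      ((summable_norm_jacobiTerm hp hp0 hx).mul_left C) ?_ ?_
    · intro m
      have h₁ : Tendsto (fun n : ℕ => qFact p (2 * n) * (qFact p ((n : ℤ) + m).toNat)⁻¹ *
          (qFact p ((n : ℤ) - m).toNat)⁻¹) atTop
          (𝓝 (eulerProd p p * (eulerProd p p)⁻¹ * (eulerProd p p)⁻¹)) := by
        have hq := tendsto_qFact hp
        refine ((hq.comp ?_).mul ((hq.comp ?_).inv₀ hP)).mul ((hq.comp ?_).inv₀ hP)
        · exact tendsto_atTop_mono (fun n => Nat.le_mul_of_pos_left n two_pos) tendsto_id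
        · refine tendsto_atTop_atTop.2 fun b => ⟨b + m.natAbs, fun a ha => by omega⟩
        · refine tendsto_atTop_atTop.2 fun b => ⟨b + m.natAbs, fun a ha => by omega⟩
      rw [mul_inv_cancel₀ hP, one_mul] at h₁
      refine (h₁.mul_const (jacobiTerm p x m)).congr' ?_
      filter_upwards [eventually_ge_atTop m.natAbs] with n hn
      have hm : m ∈ Icc (-(n : ℤ)) n := by
        rw [mem_Icc]
        omega
      simp only [f, if_pos hm]
      have h₂ := gaussBinom_eq_div hp ((n : ℤ) + m).toNat ((n : ℤ) - m).toNat
      rw [show ((n : ℤ) + m).toNat + ((n : ℤ) - m).toNat = 2 * n by omega] at h₂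
      rw [add_comm m, h₂]
    · refine Eventually.of_forall fun n m => ?_
      simp only [f]
      split_ifs
      · rw [norm_mul]
        exact mul_le_mul_of_nonneg_right (hC _ _) (norm_nonneg _)
      · rw [norm_zero]
        positivity
  have hth := (multipliable_theta hp x).tendsto_prod_tprod_nat
  simp only [hf] at hth
  rw [theta, tendsto_nhds_unique hth hlim, tsum_mul_left, mul_inv_cancel_left₀ hP]

/-! ### The addition formula for theta -/

/-- The decomposition of `ℤ × ℤ` by the parity of the sum of the coordinates. -/
def parityEquiv : (ℤ × ℤ) ⊕ (ℤ × ℤ) ≃ ℤ × ℤ where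
  toFun := Sum.elim (fun c => (c.1 + c.2, c.1 - c.2)) (fun c => (c.1 + c.2 + 1, c.1 - c.2))
  invFun c := if (c.1 + c.2) % 2 = 0 then Sum.inl ((c.1 + c.2) / 2, (c.1 - c.2) / 2)
    else Sum.inr ((c.1 + c.2) / 2, (c.1 - c.2) / 2)
  left_inv := by
    rintro (⟨a, b⟩ | ⟨a, b⟩)
    · refine (if_pos ?_).trans (congrArg Sum.inl (Prod.ext ?_ ?_)) <;>
        simp only [Sum.elim_inl] <;> omega
    · refine (if_neg ?_).trans (congrArg Sum.inr (Prod.ext ?_ ?_)) <;>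
        simp only [Sum.elim_inr] <;> omega
  right_inv := by
    rintro ⟨m, n⟩
    simp only
    split_ifs with h
    · simp only [Sum.elim_inl, Prod.mk.injEq]
      omega
    · simp only [Sum.elim_inr, Prod.mk.injEq]
      omega

/-- In the coordinates `a, b` the quadratic exponents add up without a cross term, so the variables
`x` and `y` separate. -/
theorem jacobiTerm_mul_even {p x y : ℂ} (hp0 : p ≠ 0) (hx : x ≠ 0) (hy : y ≠ 0) (a b : ℤ) :
    jacobiTerm p (x * y) (a + b) * jacobiTerm p (x / y) (a - b) =
      (p ^ (a * (a - 1)) * x ^ (2 * a)) * (p ^ (b * b) * y ^ (2 * b)) := by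
  have h₁ := two_mul_half_mul_pred (a + b)
  have h₂ := two_mul_half_mul_pred (a - b)
  have he : (a + b) * (a + b - 1) / 2 + (a - b) * (a - b - 1) / 2 = a * (a - 1) + b * b := by
    have : (a + b) * (a + b - 1) + (a - b) * (a - b - 1) = 2 * (a * (a - 1) + b * b) := by ring
    omega
  have hs : ((-1 : ℂ) ^ (a + b)) * (-1) ^ (a - b) = 1 := by
    rw [← zpow_add₀ (by norm_num), show a + b + (a - b) = 2 * a by ring, zpow_mul]
    norm_num
  have hpp : p ^ ((a + b) * (a + b - 1) / 2) * p ^ ((a - b) * (a - b - 1) / 2) =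
      p ^ (a * (a - 1)) * p ^ (b * b) := by
    rw [← zpow_add₀ hp0, he, zpow_add₀ hp0]
  have hxx : x ^ (a + b) * x ^ (a - b) = x ^ (2 * a) := by
    rw [← zpow_add₀ hx]
    congr 1
    ring
  have hyy : y ^ (a + b) * (y ^ (a - b))⁻¹ = y ^ (2 * b) := by
    rw [← zpow_neg, ← zpow_add₀ hy]
    congr 1
    ring
  rw [jacobiTerm, jacobiTerm, mul_zpow, div_zpow, div_eq_mul_inv]
  calc _ = ((-1 : ℂ) ^ (a + b) * (-1) ^ (a - b)) *
      (p ^ ((a + b) * (a + b - 1) / 2) * p ^ ((a - b) * (a - b - 1) / 2)) *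
      (x ^ (a + b) * x ^ (a - b)) * (y ^ (a + b) * (y ^ (a - b))⁻¹) := by ring
    _ = _ := by
      rw [hs, hpp, hxx, hyy]
      ring

theorem jacobiTerm_mul_odd {p x y : ℂ} (hp0 : p ≠ 0) (hx : x ≠ 0) (hy : y ≠ 0) (a b : ℤ) :
    jacobiTerm p (x * y) (a + b + 1) * jacobiTerm p (x / y) (a - b) =
      -x * ((p ^ (a * a) * x ^ (2 * a)) * (p ^ (b * (b + 1)) * y ^ (2 * b + 1))) := by
  rw [jacobiTerm_succ hp0 (mul_ne_zero hx hy), mul_assoc, jacobiTerm_mul_even hp0 hx hy,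
    zpow_add_one₀ hy, show a * a = a * (a - 1) + a by ring, show b * (b + 1) = b * b + b by ring,
    zpow_add₀ hp0 a b, zpow_add₀ hp0 (b * b), zpow_add₀ hp0 (a * (a - 1))]
  ring

/-- Up to the factor `x`, the product is a `2 × 2` determinant in functions of `x` and of `y`: in
the double Jacobi series, each parity class of the index sum factors into an `x`-series times a
`y`-series. -/
theorem exists_theta_mul_theta_eq {p : ℂ} (hp : ‖p‖ < 1) :
    ∃ A B : ℂ → ℂ, ∀ x y : ℂ, x ≠ 0 → y ≠ 0 →
      theta p (x * y) * theta p (x / y) = x * (B x * A y - A x * B y) := by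
  by_cases hp0 : p = 0
  · subst hp0
    have h0 : ∀ x, theta 0 x = 1 - x := by
      intro x
      have h1 : eulerProd 0 0 = 1 := by simp [eulerProd]
      rw [theta_eq_eulerProd (by simp), zero_div, h1, eulerProd_eq (by simp), zero_mul, h1]
      ring
    refine ⟨fun _ => 1, fun x => x + x⁻¹, fun x y hx hy => ?_⟩
    rw [h0, h0]
    field_simp
    ring
  · have hP := eulerProd_self_ne_zero hp
    let A : ℂ → ℂ := fun x => ∑' a : ℤ, p ^ (a * a) * x ^ (2 * a)
    let B : ℂ → ℂ := fun x => ∑' b : ℤ, p ^ (b * (b + 1)) * x ^ (2 * b + 1)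
    have hsq : ‖p ^ 2‖ < 1 := by
      rw [norm_pow]
      exact pow_lt_one₀ (norm_nonneg p) hp two_ne_zero
    have htwo : ∀ k : ℤ, (p ^ 2) ^ (k * (k - 1) / 2) = p ^ (k * (k - 1)) := by
      intro k
      rw [← zpow_natCast, ← zpow_mul, Nat.cast_ofNat, two_mul_half_mul_pred]
    have hA : ∀ x : ℂ, x ≠ 0 → Summable fun a : ℤ => ‖p ^ (a * a) * x ^ (2 * a)‖ := by
      intro x hx
      refine (summable_norm_jacobiTerm hsq (pow_ne_zero 2 hp0)
        (mul_ne_zero hp0 (pow_ne_zero 2 hx))).congr fun a => ?_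
      rw [jacobiTerm, htwo, norm_mul, norm_mul, norm_zpow, norm_neg, norm_one, one_zpow, one_mul,
        ← norm_mul, mul_zpow, ← mul_assoc, ← zpow_add₀ hp0, ← zpow_natCast x, ← zpow_mul]
      congr 3
      ring
    have hB : ∀ x : ℂ, x ≠ 0 → Summable fun b : ℤ => ‖p ^ (b * (b + 1)) * x ^ (2 * b + 1)‖ := by
      intro x hx
      refine ((summable_norm_jacobiTerm hsq (pow_ne_zero 2 hp0)
        (mul_ne_zero (pow_ne_zero 2 hp0) (pow_ne_zero 2 hx))).mul_right ‖x‖).congr fun b => ?_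
      rw [jacobiTerm, htwo, norm_mul, norm_mul, norm_zpow, norm_neg, norm_one, one_zpow, one_mul,
        ← norm_mul, ← norm_mul, mul_zpow, ← mul_assoc, ← zpow_natCast p, ← zpow_mul,
        ← zpow_add₀ hp0, ← zpow_natCast x, ← zpow_mul, mul_assoc, ← zpow_add_one₀ hx]
      congr 3
      push_cast
      ring
    have hshift : ∀ x : ℂ, x ≠ 0 →
        (fun a : ℤ => p ^ (a * (a - 1)) * x ^ (2 * a)) ∘ (Equiv.addRight (1 : ℤ)) =
          fun b : ℤ => x * (p ^ (b * (b + 1)) * x ^ (2 * b + 1)) := by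
      intro x hx
      funext b
      simp only [Function.comp, Equiv.coe_addRight]
      rw [show (b + 1) * (b + 1 - 1) = b * (b + 1) by ring,
        show 2 * (b + 1) = 2 * b + 1 + 1 by ring, zpow_add_one₀ hx (2 * b + 1)]
      ring
    -- Shifting the index by one identifies the `x`-series of the even class with `x B(x)`, so only
    -- two functions are needed.
    have hE : ∀ x : ℂ, x ≠ 0 → Summable (fun a : ℤ => ‖p ^ (a * (a - 1)) * x ^ (2 * a)‖) ∧
        ∑' a : ℤ, p ^ (a * (a - 1)) * x ^ (2 * a) = x * B x := by
      intro x hx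
      constructor
      · rw [← (Equiv.addRight (1 : ℤ)).summable_iff]
        refine ((hB x hx).mul_left ‖x‖).congr fun b => ?_
        rw [← norm_mul]
        exact congrArg norm (congrFun (hshift x hx) b).symm
      · rw [← (Equiv.addRight (1 : ℤ)).tsum_eq, ← tsum_mul_left]
        exact tsum_congr fun b => congrFun (hshift x hx) b
    have key : ∀ x y : ℂ, x ≠ 0 → y ≠ 0 →
        (eulerProd p p * theta p (x * y)) * (eulerProd p p * theta p (x / y)) =
          x * (B x * A y - A x * B y) := by
      intro x y hx hy
      have hs₁ := summable_norm_jacobiTerm hp hp0 (mul_ne_zero hx hy)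
      have hs₂ := summable_norm_jacobiTerm hp hp0 (div_ne_zero hx hy)
      rw [eulerProd_mul_theta hp hp0 (mul_ne_zero hx hy),
        eulerProd_mul_theta hp hp0 (div_ne_zero hx hy), tsum_mul_tsum_of_summable_norm hs₁ hs₂,
        ← parityEquiv.tsum_eq]
      have h₁ := (summable_mul_of_summable_norm (hE x hx).1 (hA y hy))
      have h₂ := (summable_mul_of_summable_norm (hA x hx) (hB y hy)).mul_left (-x)
      have e₁ : ∀ c : ℤ × ℤ, jacobiTerm p (x * y) (parityEquiv (Sum.inl c)).1 *
          jacobiTerm p (x / y) (parityEquiv (Sum.inl c)).2 =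
          (p ^ (c.1 * (c.1 - 1)) * x ^ (2 * c.1)) * (p ^ (c.2 * c.2) * y ^ (2 * c.2)) :=
        fun c => jacobiTerm_mul_even hp0 hx hy c.1 c.2
      have e₂ : ∀ c : ℤ × ℤ, jacobiTerm p (x * y) (parityEquiv (Sum.inr c)).1 *
          jacobiTerm p (x / y) (parityEquiv (Sum.inr c)).2 =
          -x * ((p ^ (c.1 * c.1) * x ^ (2 * c.1)) *
            (p ^ (c.2 * (c.2 + 1)) * y ^ (2 * c.2 + 1))) :=
        fun c => jacobiTerm_mul_odd hp0 hx hy c.1 c.2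
      rw [Summable.tsum_sum (f := fun c => jacobiTerm p (x * y) (parityEquiv c).1 *
          jacobiTerm p (x / y) (parityEquiv c).2) (h₁.congr fun c => (e₁ c).symm) (h₂.congr fun c => (e₂ c).symm),
        tsum_congr e₁, tsum_congr e₂, tsum_mul_left,
        ← tsum_mul_tsum_of_summable_norm (hE x hx).1 (hA y hy),
        ← tsum_mul_tsum_of_summable_norm (hA x hx) (hB y hy), (hE x hx).2]
      simp only [A, B]
      ring
    refine ⟨fun x => (eulerProd p p)⁻¹ * A x, fun x => (eulerProd p p)⁻¹ * B x,
      fun x y hx hy => ?_⟩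
    have := key x y hx hy
    field_simp
    linear_combination this

end

/-! ### Three-term relation and elliptic partial fractions -/

section

open Finset

/-- By the addition formula these functions of `x` lie in a two-dimensional space. The hypothesis on
`u, v` is the nonvanishing of the determinant in Cramer's rule. -/
theorem exists_theta_three_term {p : ℂ} (hp : ‖p‖ < 1) {c y u v : ℂ} (hc : c ≠ 0) (hy : y ≠ 0)
    (hu : u ≠ 0) (hv : v ≠ 0) (huv : theta p (u / v) * theta p (u * v / c) ≠ 0) :
    ∃ α β : ℂ, ∀ x : ℂ, x ≠ 0 → theta p (x / y) * theta p (x * y / c) =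
      α * (theta p (x / u) * theta p (x * u / c)) + β * (theta p (x / v) * theta p (x * v / c)) := by
  obtain ⟨A, B, hAB⟩ := exists_theta_mul_theta_eq hp
  -- A square root of `c` brings the products to the form `θ(XY) θ(X/Y)` with `X = x/r`, `Y = y/r`.
  obtain ⟨r, hr⟩ := IsAlgClosed.exists_pow_nat_eq c (n := 2) two_pos
  have hr0 : r ≠ 0 := by
    rintro rfl
    exact hc (by simpa using hr.symm)
  have hg : ∀ x y : ℂ, x ≠ 0 → y ≠ 0 → theta p (x / y) * theta p (x * y / c) =
      x / r * (B (x / r) * A (y / r) - A (x / r) * B (y / r)) := by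
    intro x y hx hy
    rw [← hAB _ _ (div_ne_zero hx hr0) (div_ne_zero hy hr0), ← hr, mul_comm,
      div_div_div_cancel_right₀ hr0]
    congr 2
    field_simp
  rw [hg u v hu hv] at huv
  have hD := right_ne_zero_of_mul huv
  refine ⟨(B (y / r) * A (v / r) - A (y / r) * B (v / r)) /
      (B (u / r) * A (v / r) - A (u / r) * B (v / r)),
    -(B (y / r) * A (u / r) - A (y / r) * B (u / r)) /
      (B (u / r) * A (v / r) - A (u / r) * B (v / r)), fun x hx => ?_⟩
  rw [hg x y hx hy, hg x u hx hu, hg x v hx hv]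
  generalize A (x / r) = ax at *
  generalize B (x / r) = bx at *
  generalize A (y / r) = ay at *
  generalize B (y / r) = by' at *
  generalize A (u / r) = au at *
  generalize B (u / r) = bu at *
  generalize A (v / r) = av at *
  generalize B (v / r) = bv at *
  generalize x / r = X at *
  rw [div_mul_eq_mul_div, div_mul_eq_mul_div, ← add_div, eq_div_iff hD]
  ring

theorem exists_theta_mul_ne_zero {p : ℂ} (hp : ‖p‖ < 1) {c x y z : ℂ} (hc : c ≠ 0) (hx : x ≠ 0)
    (hy : y ≠ 0) (hz : z ≠ 0) (hyz : theta p (y / z) ≠ 0) :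
    theta p (x * y / c) ≠ 0 ∨ theta p (x * z / c) ≠ 0 := by
  by_contra! h
  apply hyz
  have := theta_div_eq_zero hp (by positivity) (by positivity) h.1 h.2
  rwa [show x * y / c / (x * z / c) = y / z by field_simp] at this

/-- The elliptic partial fraction expansion of type `A`. -/
theorem sum_prod_theta_div_eq_zero {ι : Type*} [DecidableEq ι] {p : ℂ} (hp : ‖p‖ < 1)
    (s : Finset ι) (x : ι → ℂ) (hx : ∀ i ∈ s, x i ≠ 0)
    (hd : ∀ i ∈ s, ∀ j ∈ s, i ≠ j → theta p (x i / x j) ≠ 0)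
    (Y : Multiset ℂ) (hY : ∀ y ∈ Y, y ≠ 0) (hcard : Y.card = s.card)
    (hprod : Y.prod = ∏ i ∈ s, x i) :
    ∑ i ∈ s, (Y.map fun y => theta p (x i / y)).prod / ∏ j ∈ s.erase i, theta p (x i / x j) = 0 := by
  obtain ⟨n, hn⟩ : ∃ n, s.card = n := ⟨_, rfl⟩
  induction n generalizing s Y with
  | zero => simp [card_eq_zero.1 hn]
  | succ n ih =>
  rcases n with _ | _ | n
  · obtain ⟨i, rfl⟩ := card_eq_one.1 hn
    obtain ⟨y, rfl⟩ := Multiset.card_eq_one.1 (hcard.trans hn)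
    have : y = x i := by simpa using hprod
    have hi : x i ≠ 0 := hx i (mem_singleton_self i)
    simp [this, div_self hi, theta_one]
  · obtain ⟨i, j, hij, rfl⟩ := card_eq_two.1 hn
    obtain ⟨y, y', rfl⟩ := Multiset.card_eq_two.1 (hcard.trans hn)
    have hi : x i ≠ 0 := hx i (by simp)
    have hj : x j ≠ 0 := hx j (by simp)
    have hy : y ≠ 0 := hY y (by simp)
    have hy' : y' ≠ 0 := hY y' (by simp)
    have hpr : y * y' = x i * x j := by
      rw [prod_pair hij] at hprod
      simpa using hprod
    have h₁ := hd i (by simp) j (by simp) hij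
    rw [sum_pair hij]
    have e₁ : ({i, j} : Finset ι).erase i = {j} := by
      rw [erase_insert (by simpa using hij)]
    have e₂ : ({i, j} : Finset ι).erase j = {i} := by
      rw [pair_comm, erase_insert (by simpa using hij.symm)]
    rw [e₁, e₂]
    simp only [Multiset.insert_eq_cons, Multiset.map_cons, Multiset.map_singleton,
      Multiset.prod_cons, Multiset.prod_singleton, prod_singleton]
    rw [theta_div_comm hp hj hi, show x i / y' = y / x j by
      rw [div_eq_div_iff hy' hj, ← hpr], show x j / y' = y / x i by
      rw [div_eq_div_iff hy' hi, ← hpr.trans (mul_comm _ _)], theta_div_comm hp hi hy,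
      theta_div_comm hp hj hy]
    field_simp
    ring
  -- Fix two zeros `y, y'` and put `c = y y'`. The three-term relation rewrites `θ(x/y) θ(x/y')` in
  -- terms of functions vanishing at a node `x_i` or `x_j`. Each such function kills one summand and
  -- cancels one denominator factor in the others, leaving the identity with one node fewer.
  · have hpop : ∀ (m : ℕ) (Z : Multiset ℂ), Z.card = m + 1 → ∃ y Z', Z = y ::ₘ Z' := by
      intro m Z hZ
      obtain ⟨y, hy⟩ := Multiset.card_pos_iff_exists_mem.1 (by omega : 0 < Z.card)
      obtain ⟨Z', rfl⟩ := Multiset.exists_cons_of_mem hy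
      exact ⟨y, Z', rfl⟩
    obtain ⟨y, Y₁, rfl⟩ := hpop _ Y (hcard.trans hn)
    obtain ⟨y', Z, rfl⟩ := hpop (n + 1) Y₁ (by
      have := hcard.trans hn
      rw [Multiset.card_cons] at this
      omega)
    have hy : y ≠ 0 := hY y (by simp)
    have hy' : y' ≠ 0 := hY y' (by simp)
    have hc : y * y' ≠ 0 := mul_ne_zero hy hy'
    have hred : ∀ i ∈ s, ∑ k ∈ s, theta p (x k / x i) * theta p (x k * x i / (y * y')) *
        (Z.map fun y => theta p (x k / y)).prod / ∏ j ∈ s.erase k, theta p (x k / x j) = 0 := by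
      intro i hi
      have hxi := hx i hi
      have h := ih (s.erase i) (fun k hk => hx k (mem_of_mem_erase hk))
        (fun k hk j hj => hd k (mem_of_mem_erase hk) j (mem_of_mem_erase hj))
        ((y * y' / x i) ::ₘ Z)
        (fun w hw => by
          rcases Multiset.mem_cons.1 hw with rfl | hw
          · exact div_ne_zero hc hxi
          · exact hY w (by simp [hw]))
        (by
          rw [card_erase_of_mem hi, Multiset.card_cons]
          simp only [Multiset.card_cons] at hcard
          omega)
        (by
          rw [← mul_prod_erase s x hi, Multiset.prod_cons, Multiset.prod_cons] at hprod
          rw [Multiset.prod_cons]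
          field_simp
          linear_combination hprod)
        (by rw [card_erase_of_mem hi, hn]; omega)
      rw [← add_sum_erase s _ hi, div_self hxi, theta_one, zero_mul, zero_mul, zero_div, zero_add,
        ← h]
      refine sum_congr rfl fun k hk => ?_
      have hki := ne_of_mem_erase hk
      have hne := hd k (mem_of_mem_erase hk) i hi hki
      rw [← mul_prod_erase (s.erase k) (fun j => theta p (x k / x j))
        (mem_erase.2 ⟨hki.symm, hi⟩), erase_right_comm, Multiset.map_cons, Multiset.prod_cons,
        div_div_eq_mul_div, mul_assoc, mul_div_mul_left _ _ hne]
    -- With three nodes available, some pair has nonzero determinant. This is why one and two nodes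
    -- are treated separately.
    obtain ⟨i₁, h₁, i₂, h₂, i₃, h₃, h₁₂, h₁₃, h₂₃⟩ := two_lt_card.1 (by omega : 2 < s.card)
    obtain ⟨i, hi, j, hj, hij⟩ : ∃ i ∈ s, ∃ j ∈ s,
        theta p (x i / x j) * theta p (x i * x j / (y * y')) ≠ 0 := by
      rcases exists_theta_mul_ne_zero hp hc (hx _ h₁) (hx _ h₂) (hx _ h₃) (hd _ h₂ _ h₃ h₂₃)
        with h | h
      · exact ⟨i₁, h₁, i₂, h₂, mul_ne_zero (hd _ h₁ _ h₂ h₁₂) h⟩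
      · exact ⟨i₁, h₁, i₃, h₃, mul_ne_zero (hd _ h₁ _ h₃ h₁₃) h⟩
    obtain ⟨α, β, hαβ⟩ := exists_theta_three_term hp hc hy (hx i hi) (hx j hj) hij
    calc _ = α * (∑ k ∈ s, theta p (x k / x i) * theta p (x k * x i / (y * y')) *
          (Z.map fun y => theta p (x k / y)).prod / ∏ j ∈ s.erase k, theta p (x k / x j)) +
        β * (∑ k ∈ s, theta p (x k / x j) * theta p (x k * x j / (y * y')) *
          (Z.map fun y => theta p (x k / y)).prod / ∏ j ∈ s.erase k, theta p (x k / x j)) := by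
          rw [mul_sum, mul_sum, ← sum_add_distrib]
          refine sum_congr rfl fun k hk => ?_
          have h := hαβ (x k) (hx k hk)
          rw [Multiset.map_cons, Multiset.prod_cons, Multiset.map_cons, Multiset.prod_cons,
            ← mul_assoc, show x k / y' = x k * y / (y * y') by field_simp, h]
          ring
      _ = 0 := by rw [hred i hi, hred j hj, mul_zero, mul_zero, add_zero]

end

/-! ### Pochhammer symbols, Weyl denominators and interpolation -/

section

open Finset

theorem poch_zero (p q a : ℂ) : poch p q a 0 = 1 := by simp [poch]

theorem poch_succ (p q a : ℂ) (k : ℕ) : poch p q a (k + 1) = poch p q a k * theta p (a * q ^ k) :=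
  prod_range_succ _ _

theorem poch_succ' (p q a : ℂ) (k : ℕ) :
    poch p q a (k + 1) = theta p a * poch p q (a * q) k := by
  rw [poch, prod_range_succ', mul_comm, pow_zero, mul_one, poch]
  congr 1
  refine prod_congr rfl fun i _ => ?_
  rw [pow_succ', mul_assoc]

theorem poch_mul_theta (p q a : ℂ) (k : ℕ) :
    poch p q a k * theta p (a * q ^ k) = theta p a * poch p q (a * q) k := by
  rw [← poch_succ, poch_succ']

theorem Delta_ne_zero {p : ℂ} {n : ℕ} {z : Fin n → ℂ} (hz : ∀ j, z j ≠ 0)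
    (hd : ∀ j k, j ≠ k → theta p (z j / z k) ≠ 0) : Delta p z ≠ 0 :=
  prod_ne_zero_iff.2 fun j _ => prod_ne_zero_iff.2 fun k hk =>
    mul_ne_zero (hz j) (hd k j (mem_Ioi.1 hk).ne')

theorem prod_erase_eq_ite {ι M : Type*} [Fintype ι] [DecidableEq ι] [CommMonoid M] (i : ι)
    (f : ι → M) : ∏ j ∈ univ.erase i, f j = ∏ j, if j = i then 1 else f j := by
  rw [← mul_prod_erase univ _ (mem_univ i), if_pos rfl, one_mul]
  exact prod_congr rfl fun j hj => (if_neg (ne_of_mem_erase hj)).symm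

/-- The pairs `j < l` containing `k` correspond to the indices other than `k`. This isolates the
factors of `Delta` affected by moving one node. -/
theorem prod_prod_Ioi_ite {n : ℕ} (k : Fin n) (f : Fin n → ℂ) :
    ∏ j : Fin n, ∏ l ∈ Ioi j, (if j = k then f l else if l = k then f j else 1) =
      ∏ j ∈ univ.erase k, f j := by
  rw [← mul_prod_erase univ _ (mem_univ k)]
  have h₁ : ∏ l ∈ Ioi k, (if k = k then f l else if l = k then f k else 1) =
      ∏ j ∈ univ.erase k, if k < j then f j else 1 := by
    rw [← prod_filter]
    refine prod_congr ?_ fun l _ => if_pos rfl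
    ext l
    simp only [mem_Ioi, mem_filter, mem_erase, mem_univ, and_true]
    exact ⟨fun h => ⟨h.ne', h⟩, fun h => h.2⟩
  have h₂ : ∏ j ∈ univ.erase k, ∏ l ∈ Ioi j, (if j = k then f l else if l = k then f j else 1) =
      ∏ j ∈ univ.erase k, if k < j then 1 else f j := by
    refine prod_congr rfl fun j hj => ?_
    have hjk := ne_of_mem_erase hj
    simp only [if_neg hjk]
    rw [prod_ite_eq' (Ioi j) k]
    rcases lt_or_gt_of_ne hjk with h | h
    · rw [if_pos (mem_Ioi.2 h), if_neg h.not_gt]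
    · rw [if_neg (fun h' => (mem_Ioi.1 h').not_gt h), if_pos h]
  rw [h₁, h₂, ← prod_mul_distrib]
  refine prod_congr rfl fun j _ => ?_
  split_ifs <;> simp

theorem Delta_update_mul {p q : ℂ} (hp : ‖p‖ < 1) (hq : q ≠ 0) {n : ℕ} {z : Fin n → ℂ}
    (hz : ∀ j, z j ≠ 0) (k : Fin n) :
    Delta p (Function.update z k (z k * q)) * ∏ j ∈ univ.erase k, theta p (z k / z j) =
      Delta p z * ∏ j ∈ univ.erase k, theta p (q * z k / z j) := by
  rw [← prod_prod_Ioi_ite k, ← prod_prod_Ioi_ite k, Delta, Delta, ← prod_mul_distrib,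
    ← prod_mul_distrib]
  refine prod_congr rfl fun j _ => ?_
  rw [← prod_mul_distrib, ← prod_mul_distrib]
  refine prod_congr rfl fun l hl => ?_
  have hjl : l ≠ j := (mem_Ioi.1 hl).ne'
  by_cases hj : j = k
  · subst hj
    rw [if_pos rfl, if_pos rfl, Function.update_self, Function.update_of_ne hjl,
      theta_div_comm hp (hz l) (mul_ne_zero (hz j) hq), theta_div_comm hp (hz l) (hz j),
      mul_comm q]
    have := hz j
    field_simp
  · rw [if_neg hj, if_neg hj, Function.update_of_ne hj]
    by_cases hlk : l = k
    · subst hlk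
      rw [if_pos rfl, if_pos rfl, Function.update_self, mul_comm q]
      ring
    · rw [if_neg hlk, if_neg hlk, Function.update_of_ne hlk]

/-- Partial fractions at the `n + 1` nodes `X, 1/z_k` with zeros `XQ, 1/v_j`; the right side is the
contribution of the node `X`. It provides the weights summing to one in `ellSum_succ`. -/
theorem sum_theta_interpolation {p : ℂ} (hp : ‖p‖ < 1) {n : ℕ} {z v : Fin n → ℂ} {X Q : ℂ}
    (hz : ∀ j, z j ≠ 0) (hv : ∀ j, v j ≠ 0) (hX : X ≠ 0) (hQ : Q ≠ 0)
    (hd : ∀ j k, j ≠ k → theta p (z j / z k) ≠ 0) (hXz : ∀ j, theta p (X * z j) ≠ 0)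
    (hvz : ∏ j, v j = Q * ∏ j, z j) :
    ∑ k, theta p (X * Q * z k) *
        (∏ j ∈ univ.erase k, theta p (X * z j) / theta p (z j / z k)) * ∏ j, theta p (v j / z k) =
      theta p Q * ∏ j, theta p (X * v j) := by
  let x : Option (Fin n) → ℂ := fun i => i.elim X fun k => (z k)⁻¹
  have hx : ∀ i, x i ≠ 0 := by
    rintro (_ | k)
    · exact hX
    · exact inv_ne_zero (hz k)
  have hXz' : ∀ k, theta p ((z k)⁻¹ / X) = -(X * z k)⁻¹ * theta p (X * z k) := by
    intro k
    rw [← theta_inv hp (mul_ne_zero hX (hz k))]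
    congr 1
    field_simp
  have h := sum_prod_theta_div_eq_zero hp univ x (fun i _ => hx i)
    (by
      rintro (_ | j) - (_ | k) - hjk
      · exact absurd rfl hjk
      · simpa [x] using hXz k
      · change theta p ((z j)⁻¹ / X) ≠ 0
        rw [hXz']
        exact mul_ne_zero (neg_ne_zero.2 (inv_ne_zero (mul_ne_zero hX (hz j)))) (hXz j)
      · have := hd k j (fun h => hjk (by rw [h]))
        rwa [show z k / z j = x (some j) / x (some k) by
          simp only [x, Option.elim]
          field_simp] at this)
    ((X * Q) ::ₘ (univ.val.map fun j => (v j)⁻¹))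
    (by
      intro y hy
      rcases Multiset.mem_cons.1 hy with rfl | hy
      · exact mul_ne_zero hX hQ
      · obtain ⟨j, -, rfl⟩ := Multiset.mem_map.1 hy
        exact inv_ne_zero (hv j))
    (by simp)
    (by
      rw [Multiset.prod_cons, Fintype.prod_option]
      change X * Q * ∏ j, (v j)⁻¹ = X * ∏ j, (z j)⁻¹
      have : ∏ j, z j ≠ 0 := prod_ne_zero_iff.2 fun j _ => hz j
      rw [prod_inv_distrib, prod_inv_distrib, hvz]
      field_simp)
  simp only [prod_erase_eq_ite] at h
  rw [Fintype.sum_option] at h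
  simp only [Fintype.prod_option, Option.some_inj, reduceCtorEq, if_true, if_false, one_mul,
    Multiset.map_cons, Multiset.prod_cons, Multiset.map_map, Function.comp, x, Option.elim] at h
  have hmap : ∀ c : ℂ, ((univ : Finset (Fin n)).val.map fun j => theta p (c / (v j)⁻¹)).prod =
      ∏ j, theta p (c * v j) := by
    intro c
    simp only [div_inv_eq_mul]
    rfl
  simp only [hmap] at h
  have hP : ∏ j, theta p (X * z j) ≠ 0 := prod_ne_zero_iff.2 fun j _ => hXz j
  have hQ' : theta p (X / (X * Q)) = -Q⁻¹ * theta p Q := by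
    rw [← theta_inv hp hQ]
    congr 1
    field_simp
  have hQz : ∀ k, theta p ((z k)⁻¹ / (X * Q)) = -(X * Q * z k)⁻¹ * theta p (X * Q * z k) := by
    intro k
    rw [← theta_inv hp (mul_ne_zero (mul_ne_zero hX hQ) (hz k))]
    congr 1
    have := hz k
    field_simp
  rw [hQ'] at h
  simp only [div_inv_eq_mul, hXz', hQz] at h
  have hterm : ∀ k, theta p (X * Q * z k) *
        (∏ j ∈ univ.erase k, theta p (X * z j) / theta p (z j / z k)) * ∏ j, theta p (v j / z k) =
      Q * (∏ j, theta p (X * z j)) * (-(X * Q * z k)⁻¹ * theta p (X * Q * z k) *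
        (∏ j, theta p ((z k)⁻¹ * v j)) / (-(X * z k)⁻¹ * theta p (X * z k) *
        ∏ j, if j = k then 1 else theta p ((z k)⁻¹ * z j))) := by
    intro k
    rw [← prod_erase_eq_ite, prod_div_distrib,
      ← mul_prod_erase univ (fun j => theta p (X * z j)) (mem_univ k)]
    simp only [div_eq_inv_mul, mul_comm (z k)⁻¹]
    have h₁ := hXz k
    have h₂ := hz k
    have h₃ : ∏ j ∈ univ.erase k, theta p (z j * (z k)⁻¹) ≠ 0 :=
      prod_ne_zero_iff.2 fun j hj => by
        rw [← div_eq_mul_inv]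
        exact hd j k (ne_of_mem_erase hj)
    field_simp
  rw [sum_congr rfl fun k _ => hterm k, ← mul_sum]
  rw [add_eq_zero_iff_eq_neg'] at h
  rw [h]
  field_simp

end

/-! ### The recursion in `N` -/

section

open Finset

/-- The summand of `ellSum`. -/
def ellTerm (p q : ℂ) {n l m : ℕ} (z : Fin n → ℂ) (a : Fin l → ℂ) (w : Fin m → ℂ)
    (y : Fin n → ℕ) : ℂ :=
  Delta p (fun k => z k * q ^ y k) / Delta p z *
    ∏ k : Fin n, (∏ j : Fin l, poch p q (a j * z k) (y k)) /
      ((∏ j : Fin m, poch p q (w j * z k) (y k)) *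
        ∏ j : Fin n, poch p q (q * z k / z j) (y k))

theorem ellSum_eq_sum_ellTerm (p q : ℂ) (N : ℕ) {n l m : ℕ} (z : Fin n → ℂ) (a : Fin l → ℂ)
    (w : Fin m → ℂ) :
    ellSum p q N z a w = ∑ y ∈ piAntidiag (univ : Finset (Fin n)) N, ellTerm p q z a w y := rfl

/-- No product of an integer power of `q` with one of `z_j / z_k`, `c z_k` is a zero of the theta
function. -/
structure GenericNodes (p q : ℂ) {n : ℕ} (z : Fin n → ℂ) (c : ℂ) : Prop where
  ne_zero : ∀ j, z j ≠ 0
  coeff_ne_zero : c ≠ 0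
  theta_div : ∀ j k, j ≠ k → ∀ s : ℤ, theta p (q ^ s * (z j / z k)) ≠ 0
  theta_mul : ∀ k, ∀ s : ℤ, theta p (q ^ s * (c * z k)) ≠ 0

theorem GenericNodes.shift {p q : ℂ} (hq : q ≠ 0) {n : ℕ} {z z' : Fin n → ℂ} {c c' : ℂ}
    (h : GenericNodes p q z c) (e : Fin n → ℤ) (f : ℤ) (hz : ∀ j, z' j = q ^ e j * z j)
    (hc : c' = q ^ f * c) : GenericNodes p q z' c' where
  ne_zero j := by
    rw [hz]
    exact mul_ne_zero (zpow_ne_zero _ hq) (h.ne_zero j)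
  coeff_ne_zero := by
    rw [hc]
    exact mul_ne_zero (zpow_ne_zero _ hq) h.coeff_ne_zero
  theta_div j k hjk s := by
    rw [hz, hz, show q ^ s * (q ^ e j * z j / (q ^ e k * z k)) =
      q ^ (s + e j - e k) * (z j / z k) by
        rw [zpow_sub₀ hq, zpow_add₀ hq, mul_div_mul_comm]
        ring]
    exact h.theta_div j k hjk _
  theta_mul k s := by
    rw [hz, hc, show q ^ s * (q ^ f * c * (q ^ e k * z k)) = q ^ (s + f + e k) * (c * z k) by
        rw [zpow_add₀ hq, zpow_add₀ hq]
        ring]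
    exact h.theta_mul k _

theorem GenericNodes.update {p q : ℂ} (hq : q ≠ 0) {n : ℕ} {z : Fin n → ℂ} {c : ℂ}
    (h : GenericNodes p q z c) (k : Fin n) :
    GenericNodes p q (Function.update z k (z k * q)) (c / q) := by
  refine h.shift hq (fun j => if j = k then 1 else 0) (-1) (fun j => ?_) ?_
  · by_cases hj : j = k
    · subst hj
      simp [mul_comm]
    · simp [hj]
  · rw [zpow_neg_one, div_eq_inv_mul]

/-- The coefficients of the recursion `ellSum_succ`. -/
def recCoeff (p q : ℂ) (N : ℕ) {n l m : ℕ} (z : Fin n → ℂ) (a : Fin l → ℂ) (w : Fin m → ℂ)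
    (i : Fin l) (k : Fin n) : ℂ :=
  theta p (q ^ N * (a i * z k)) / theta p (q ^ (N + 1)) * ((∏ j ∈ univ.erase i, theta p (a j * z k)) /
    ((∏ j, theta p (w j * z k)) * ∏ j ∈ univ.erase k, theta p (z k / z j)))

/-- For `j ≠ i` only the symbol at `z_k` loses its first factor. For `j = i`, the argument `a_i z_k`
is unchanged and the symbol loses its last factor, while at the other nodes the argument moves down
by `q`. -/
theorem prod_poch_num_update {p q : ℂ} (hq : q ≠ 0) {n l : ℕ} (z : Fin n → ℂ) (a : Fin l → ℂ)
    (i : Fin l) (k : Fin n) {y y' : Fin n → ℕ} (hyk : y k = y' k + 1) (hy : ∀ j ≠ k, y j = y' j) :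
    (∏ r, ∏ j, poch p q (Function.update a i (a i / q) j * Function.update z k (z k * q) r) (y' r)) *
        (∏ j ∈ univ.erase i, theta p (a j * z k)) * ∏ r, theta p (a i / q * (z r * q ^ y r)) =
      (∏ r, ∏ j, poch p q (a j * z r) (y r)) * ∏ r ∈ univ.erase k, theta p (a i / q * z r) := by
  have h₁ : (∏ j, poch p q (Function.update a i (a i / q) j * (z k * q)) (y' k)) *
      ((∏ j ∈ univ.erase i, theta p (a j * z k)) * theta p (a i / q * (z k * q ^ y k))) =
      ∏ j, poch p q (a j * z k) (y k) := by
    rw [← mul_prod_erase univ _ (mem_univ i), ← mul_prod_erase univ _ (mem_univ i),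
      Function.update_self]
    have e₁ : poch p q (a i / q * (z k * q)) (y' k) * theta p (a i / q * (z k * q ^ y k)) =
        poch p q (a i * z k) (y k) := by
      rw [hyk, poch_succ, show a i / q * (z k * q) = a i * z k by field_simp,
        show a i / q * (z k * q ^ (y' k + 1)) = a i * z k * q ^ y' k by
          field_simp
          ring]
    have e₂ : (∏ j ∈ univ.erase i, poch p q (Function.update a i (a i / q) j * (z k * q)) (y' k)) *
        (∏ j ∈ univ.erase i, theta p (a j * z k)) =
        ∏ j ∈ univ.erase i, poch p q (a j * z k) (y k) := by
      rw [← prod_mul_distrib]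
      refine prod_congr rfl fun j hj => ?_
      rw [Function.update_of_ne (ne_of_mem_erase hj), hyk, poch_succ', mul_comm, mul_assoc (a j)]
    rw [← e₁, ← e₂]
    ring
  have h₂ : ∀ r ∈ univ.erase k,
      (∏ j, poch p q (Function.update a i (a i / q) j * z r) (y' r)) *
        theta p (a i / q * (z r * q ^ y r)) =
      (∏ j, poch p q (a j * z r) (y r)) * theta p (a i / q * z r) := by
    intro r hr
    rw [← mul_prod_erase univ _ (mem_univ i), ← mul_prod_erase univ _ (mem_univ i),
      Function.update_self, hy r (ne_of_mem_erase hr)]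
    have e₁ := poch_mul_theta p q (a i / q * z r) (y' r)
    rw [show a i / q * z r * q = a i * z r by field_simp, mul_assoc (a i / q)] at e₁
    have e₂ : ∏ j ∈ univ.erase i, poch p q (Function.update a i (a i / q) j * z r) (y' r) =
        ∏ j ∈ univ.erase i, poch p q (a j * z r) (y' r) :=
      prod_congr rfl fun j hj => by rw [Function.update_of_ne (ne_of_mem_erase hj)]
    rw [e₂]
    linear_combination (∏ j ∈ univ.erase i, poch p q (a j * z r) (y' r)) * e₁
  have h₃ := prod_congr rfl h₂
  rw [prod_mul_distrib, prod_mul_distrib] at h₃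
  rw [← mul_prod_erase univ _ (mem_univ k), ← mul_prod_erase univ _ (mem_univ k),
    ← mul_prod_erase univ _ (mem_univ k), Function.update_self, ← h₁]
  have e₃ : (∏ r ∈ univ.erase k, ∏ j,
        poch p q (Function.update a i (a i / q) j * Function.update z k (z k * q) r) (y' r)) =
      ∏ r ∈ univ.erase k, ∏ j, poch p q (Function.update a i (a i / q) j * z r) (y' r) :=
    prod_congr rfl fun r hr => by rw [Function.update_of_ne (ne_of_mem_erase hr)]
  rw [e₃]
  linear_combination ((∏ j, poch p q (Function.update a i (a i / q) j * (z k * q)) (y' k)) *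
      ((∏ j ∈ univ.erase i, theta p (a j * z k)) * theta p (a i / q * (z k * q ^ y k)))) * h₃

theorem prod_poch_den_update (p q : ℂ) {n m : ℕ} (z : Fin n → ℂ) (w : Fin m → ℂ) (k : Fin n)
    {y y' : Fin n → ℕ} (hyk : y k = y' k + 1) (hy : ∀ j ≠ k, y j = y' j) :
    (∏ r, ∏ j, poch p q (w j * Function.update z k (z k * q) r) (y' r)) *
        (∏ j, theta p (w j * z k)) = ∏ r, ∏ j, poch p q (w j * z r) (y r) := by
  rw [← mul_prod_erase univ _ (mem_univ k), ← mul_prod_erase univ _ (mem_univ k),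
    Function.update_self, mul_right_comm, ← prod_mul_distrib]
  congr 1
  · refine prod_congr rfl fun j _ => ?_
    rw [hyk, poch_succ', mul_comm, mul_assoc]
  · refine prod_congr rfl fun r hr => ?_
    rw [Function.update_of_ne (ne_of_mem_erase hr), hy r (ne_of_mem_erase hr)]

theorem prod_poch_nodes_update {p q : ℂ} (hq : q ≠ 0) {n : ℕ} {z : Fin n → ℂ}
    (hz : ∀ j, z j ≠ 0) (k : Fin n)
    {y y' : Fin n → ℕ} (hyk : y k = y' k + 1) (hy : ∀ j ≠ k, y j = y' j) :
    (∏ r, ∏ j, poch p q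
        (q * Function.update z k (z k * q) r / Function.update z k (z k * q) j) (y' r)) *
        (∏ j ∈ univ.erase k, theta p (q * z k / z j)) * ∏ r, theta p (z r * q ^ y r / z k) =
      (∏ r, ∏ j, poch p q (q * z r / z j) (y r)) * ∏ j ∈ univ.erase k, theta p (z j / z k) := by
  have hzk := hz k
  have h₁ : (∏ j, poch p q (q * (z k * q) / Function.update z k (z k * q) j) (y' k)) *
      ((∏ j ∈ univ.erase k, theta p (q * z k / z j)) * theta p (z k * q ^ y k / z k)) =
      ∏ j, poch p q (q * z k / z j) (y k) := by
    rw [← mul_prod_erase univ _ (mem_univ k), ← mul_prod_erase univ _ (mem_univ k),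
      Function.update_self]
    have e₁ : poch p q (q * (z k * q) / (z k * q)) (y' k) * theta p (z k * q ^ y k / z k) =
        poch p q (q * z k / z k) (y k) := by
      rw [hyk, poch_succ, mul_div_cancel_right₀ _ (mul_ne_zero hzk hq),
        mul_div_cancel_right₀ _ hzk, mul_div_cancel_left₀ _ hzk, pow_succ']
    have e₂ : (∏ j ∈ univ.erase k,
          poch p q (q * (z k * q) / Function.update z k (z k * q) j) (y' k)) *
        (∏ j ∈ univ.erase k, theta p (q * z k / z j)) =
        ∏ j ∈ univ.erase k, poch p q (q * z k / z j) (y k) := by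
      rw [← prod_mul_distrib]
      refine prod_congr rfl fun j hj => ?_
      rw [Function.update_of_ne (ne_of_mem_erase hj), hyk, poch_succ', mul_comm,
        show q * (z k * q) / z j = q * z k / z j * q by ring]
    rw [← e₁, ← e₂]
    ring
  have h₂ : ∀ r ∈ univ.erase k,
      (∏ j, poch p q (q * z r / Function.update z k (z k * q) j) (y' r)) *
        theta p (z r * q ^ y r / z k) =
      (∏ j, poch p q (q * z r / z j) (y r)) * theta p (z r / z k) := by
    intro r hr
    rw [← mul_prod_erase univ _ (mem_univ k), ← mul_prod_erase univ _ (mem_univ k),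
      Function.update_self, hy r (ne_of_mem_erase hr)]
    have e₁ := poch_mul_theta p q (z r / z k) (y' r)
    rw [show z r / z k * q = q * z r / z k by ring, div_mul_eq_mul_div] at e₁
    have e₂ : ∏ j ∈ univ.erase k, poch p q (q * z r / Function.update z k (z k * q) j) (y' r) =
        ∏ j ∈ univ.erase k, poch p q (q * z r / z j) (y' r) :=
      prod_congr rfl fun j hj => by rw [Function.update_of_ne (ne_of_mem_erase hj)]
    rw [e₂, show q * z r / (z k * q) = z r / z k by field_simp]
    linear_combination (∏ j ∈ univ.erase k, poch p q (q * z r / z j) (y' r)) * e₁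
  have h₃ := prod_congr rfl h₂
  rw [prod_mul_distrib, prod_mul_distrib] at h₃
  rw [← mul_prod_erase univ (fun r => ∏ j, poch p q
      (q * Function.update z k (z k * q) r / Function.update z k (z k * q) j) (y' r)) (mem_univ k),
    ← mul_prod_erase univ (fun r => ∏ j, poch p q (q * z r / z j) (y r)) (mem_univ k),
    ← mul_prod_erase univ (fun r => theta p (z r * q ^ y r / z k)) (mem_univ k),
    Function.update_self, ← h₁]
  have e₃ : (∏ r ∈ univ.erase k, ∏ j, poch p q
        (q * Function.update z k (z k * q) r / Function.update z k (z k * q) j) (y' r)) =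
      ∏ r ∈ univ.erase k, ∏ j, poch p q (q * z r / Function.update z k (z k * q) j) (y' r) :=
    prod_congr rfl fun r hr => by simp only [Function.update_of_ne (ne_of_mem_erase hr)]
  rw [e₃]
  linear_combination ((∏ j, poch p q (q * (z k * q) / Function.update z k (z k * q) j) (y' k)) *
      ((∏ j ∈ univ.erase k, theta p (q * z k / z j)) * theta p (z k * q ^ y k / z k))) * h₃

/-- Combines the four update identities. Only the auxiliary factors `L, U, V, R` must be nonzero. -/
theorem div_mul_div_of_mul_eq {K : Type*} [Field K]
    {A A' W W' D D' Δ Δ' δ PA PW PZ L M U V R c d : K}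
    (hA : A' * PA * L = A * M) (hW : W' * PW = W) (hD : D' * U * V = D * R)
    (hΔ : Δ' * PZ = Δ * U) (hL : L ≠ 0) (hU : U ≠ 0) (hV : V ≠ 0) (hR : R ≠ 0) :
    c / d * (PA / (PW * PZ)) * (δ / Δ' * (A' / (W' * D'))) =
      δ / Δ * (A / (W * D)) * (c * (M / R) * V / (d * L)) := by
  have hA' : A' * PA = A * M / L := eq_div_of_mul_eq hL hA
  have hD' : D' = D * R / (U * V) := eq_div_of_mul_eq (mul_ne_zero hU hV) (by rw [← hD]; ring)
  calc _ = c / d * δ * (A' * PA) / ((W' * PW) * (Δ' * PZ) * D') := by ring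
    _ = _ := by
      rw [hA', hW, hΔ, hD']
      field_simp

theorem recCoeff_mul_ellTerm {p q : ℂ} (hp : ‖p‖ < 1) (hq : q ≠ 0) {N n l m : ℕ}
    (hqN : ∀ i, 1 ≤ i → i ≤ N + 1 → theta p (q ^ i) ≠ 0)
    {z : Fin n → ℂ} (a : Fin l → ℂ) (w : Fin m → ℂ) (i : Fin l) (k : Fin n)
    (hg : GenericNodes p q z (a i))
    {y y' : Fin n → ℕ} (hyk : y k = y' k + 1) (hy : ∀ j ≠ k, y j = y' j) (hyN : y k ≤ N + 1) :
    recCoeff p q N z a w i k *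
        ellTerm p q (Function.update z k (z k * q)) (Function.update a i (a i / q)) w y' =
      ellTerm p q z a w y * (theta p (a i / q * q ^ (N + 1) * z k) *
        (∏ j ∈ univ.erase k, theta p (a i / q * z j) / theta p (z j / z k)) *
        (∏ j, theta p (z j * q ^ y j / z k)) /
        (theta p (q ^ (N + 1)) * ∏ j, theta p (a i / q * (z j * q ^ y j)))) := by
  have hz := hg.ne_zero
  have hA := prod_poch_num_update (p := p) hq z a i k hyk hy
  have hW := prod_poch_den_update p q z w k hyk hy
  have hD := prod_poch_nodes_update (p := p) hq hz k hyk hy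
  have hΔ := Delta_update_mul hp hq hz k
  have hδ : (fun j => Function.update z k (z k * q) j * q ^ y' j) = fun j => z j * q ^ y j := by
    funext j
    by_cases hj : j = k
    · subst hj
      rw [Function.update_self, hyk, pow_succ]
      ring
    · rw [Function.update_of_ne hj, hy j hj]
  have hL : ∏ j, theta p (a i / q * (z j * q ^ y j)) ≠ 0 :=
    prod_ne_zero_iff.2 fun j _ => by
      have := hg.theta_mul j ((y j : ℤ) - 1)
      rwa [zpow_sub_one₀ hq, zpow_natCast,
        show q ^ y j * q⁻¹ * (a i * z j) = a i / q * (z j * q ^ y j) by ring] at this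
  have hU : ∏ j ∈ univ.erase k, theta p (q * z k / z j) ≠ 0 :=
    prod_ne_zero_iff.2 fun j hj => by
      have := hg.theta_div k j (ne_of_mem_erase hj).symm 1
      rwa [zpow_one, ← mul_div_assoc] at this
  have hV : ∏ j, theta p (z j * q ^ y j / z k) ≠ 0 :=
    prod_ne_zero_iff.2 fun j _ => by
      by_cases hj : j = k
      · subst hj
        rw [mul_div_cancel_left₀ _ (hz j)]
        exact hqN _ (by omega) hyN
      · have := hg.theta_div j k hj (y j)
        rwa [zpow_natCast, ← mul_div_assoc, mul_comm] at this
  have hR : ∏ j ∈ univ.erase k, theta p (z j / z k) ≠ 0 :=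
    prod_ne_zero_iff.2 fun j hj => by
      have := hg.theta_div j k (ne_of_mem_erase hj) 0
      rwa [zpow_zero, one_mul] at this
  have hc : a i / q * q ^ (N + 1) * z k = q ^ N * (a i * z k) := by
    rw [pow_succ]
    field_simp
  rw [ellTerm, ellTerm, recCoeff, hδ, hc]
  simp only [prod_div_distrib, prod_mul_distrib]
  exact div_mul_div_of_mul_eq hA hW hD hΔ hL hU hV hR

/-- Each term is multiplied by `1 = ∑_k ρ y k`, which is the interpolation identity with `X =
a_i/q`, `Q = q^(N+1)` and `v_j = z_j q^(y_j)`. The part belonging to `k` is then a term of the sum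
with `z_k` and `a_i` shifted. -/
theorem ellSum_succ {p q : ℂ} (hp : ‖p‖ < 1) (hq : q ≠ 0) {N n l m : ℕ}
    (hqN : ∀ i, 1 ≤ i → i ≤ N + 1 → theta p (q ^ i) ≠ 0)
    {z : Fin n → ℂ} (a : Fin l → ℂ) (w : Fin m → ℂ) (i : Fin l)
    (hg : GenericNodes p q z (a i)) :
    ellSum p q (N + 1) z a w = ∑ k, recCoeff p q N z a w i k *
      ellSum p q N (Function.update z k (z k * q)) (Function.update a i (a i / q)) w := by
  have hz := hg.ne_zero
  let ρ : (Fin n → ℕ) → Fin n → ℂ := fun y k => theta p (a i / q * q ^ (N + 1) * z k) *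
        (∏ j ∈ univ.erase k, theta p (a i / q * z j) / theta p (z j / z k)) *
        (∏ j, theta p (z j * q ^ y j / z k)) /
        (theta p (q ^ (N + 1)) * ∏ j, theta p (a i / q * (z j * q ^ y j)))
  have hρ : ∀ y ∈ piAntidiag (univ : Finset (Fin n)) (N + 1), ∑ k, ρ y k = 1 := by
    intro y hy
    have hsum := (mem_piAntidiag.1 hy).1
    rw [← sum_div, sum_theta_interpolation hp hz (fun j => mul_ne_zero (hz j) (pow_ne_zero _ hq))
      (div_ne_zero hg.coeff_ne_zero hq) (pow_ne_zero _ hq)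
      (fun j k hjk => by simpa using hg.theta_div j k hjk 0)
      (fun j => by
        have := hg.theta_mul j (-1)
        rwa [zpow_neg_one, show q⁻¹ * (a i * z j) = a i / q * z j by ring] at this)
      (by rw [prod_mul_distrib, prod_pow_eq_pow_sum, hsum, mul_comm])]
    refine div_self (mul_ne_zero (hqN _ (by omega) le_rfl) (prod_ne_zero_iff.2 fun j _ => ?_))
    have := hg.theta_mul j ((y j : ℤ) - 1)
    rwa [zpow_sub_one₀ hq, zpow_natCast,
      show q ^ y j * q⁻¹ * (a i * z j) = a i / q * (z j * q ^ y j) by ring] at this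
  have hk : ∀ k, recCoeff p q N z a w i k *
      ellSum p q N (Function.update z k (z k * q)) (Function.update a i (a i / q)) w =
      ∑ y ∈ piAntidiag (univ : Finset (Fin n)) (N + 1), ellTerm p q z a w y * ρ y k := by
    intro k
    rw [ellSum_eq_sum_ellTerm, mul_sum]
    -- Substitute `y = y' + e_k`. Tuples not of this form have `y_k = 0`, and then `ρ y k` contains
    -- the factor `θ(1) = 0`.
    refine sum_of_injOn (fun y => y + Pi.single k 1) (fun y _ y' _ h => add_right_cancel h) ?_ ?_ ?_
    · intro y hy
      have hsum := (mem_piAntidiag.1 (mem_coe.1 hy)).1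
      refine mem_coe.2 (mem_piAntidiag.2 ⟨?_, fun _ _ => mem_univ _⟩)
      simp only [Pi.add_apply, sum_add_distrib]
      rw [hsum, sum_pi_single' k 1, if_pos (mem_univ k)]
    · intro y hy hy'
      have hsum := (mem_piAntidiag.1 hy).1
      have h0 : y k = 0 := by
        by_contra h0
        refine hy' ⟨y - Pi.single k 1, ?_, ?_⟩
        · refine mem_coe.2 (mem_piAntidiag.2 ⟨?_, fun _ _ => mem_univ _⟩)
          have h₁ : ∑ j, (y - Pi.single k 1 : Fin n → ℕ) j + ∑ j, (Pi.single k 1 : Fin n → ℕ) j = ∑ j, y j := by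
            rw [← sum_add_distrib]
            refine sum_congr rfl fun j _ => ?_
            by_cases hj : j = k
            · subst hj
              simp only [Pi.sub_apply, Pi.single_eq_same]
              omega
            · simp [hj]
          rw [sum_pi_single' k 1, if_pos (mem_univ k), hsum] at h₁
          exact Nat.succ.inj h₁
        · funext j
          by_cases hj : j = k
          · subst hj
            simp only [Pi.add_apply, Pi.sub_apply, Pi.single_eq_same]
            omega
          · simp [hj]
      have h1 : ∏ j, theta p (z j * q ^ y j / z k) = 0 :=
        prod_eq_zero (mem_univ k) (by rw [h0, pow_zero, mul_one, div_self (hz k), theta_one])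
      simp only [ρ, h1, mul_zero, zero_div]
    · intro y hy
      have hsum := (mem_piAntidiag.1 hy).1
      have hle : y k ≤ N := hsum ▸ single_le_sum (fun _ _ => Nat.zero_le _) (mem_univ k)
      exact recCoeff_mul_ellTerm hp hq hqN a w i k hg (by simp)
        (fun j hj => by simp [hj]) (by simpa using hle)
  rw [sum_congr rfl fun k _ => hk k, sum_comm, ellSum_eq_sum_ellTerm]
  refine sum_congr rfl fun y hy => ?_
  rw [← mul_sum, hρ y hy, mul_one]

end

/-! ### Duality between `A_n` and `A_m` sums -/

section

open Finset

theorem GenericNodes.Delta_ne_zero {p q : ℂ} {n : ℕ} {z : Fin n → ℂ} {c : ℂ}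
    (h : GenericNodes p q z c) : Delta p z ≠ 0 :=
  EllipticHyp.Delta_ne_zero h.ne_zero fun j k hjk => by simpa using h.theta_div j k hjk 0

theorem ellSum_zero {p q : ℂ} {n l m : ℕ} {z : Fin n → ℂ} (hz : Delta p z ≠ 0) (a : Fin l → ℂ)
    (w : Fin m → ℂ) : ellSum p q 0 z a w = 1 := by
  rw [ellSum, piAntidiag_zero, sum_singleton]
  simp [poch_zero, div_self hz]

/-- Genericity and balancing conditions for the duality between `A_n` and `A_m` sums. -/
structure DualGeneric (p q : ℂ) {n l m : ℕ} (z : Fin n → ℂ) (a : Fin l → ℂ) (w : Fin m → ℂ)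
    (i : Fin l) : Prop where
  card : l = n + m
  left : GenericNodes p q z (a i)
  right : GenericNodes p q w (a i)⁻¹
  ne_zero : ∀ j, a j ≠ 0
  cross : ∀ j k, ∀ s : ℤ, theta p (q ^ s * (w j * z k)) ≠ 0
  balanced : ∏ j, w j = (∏ j, z j) * ∏ j, a j

theorem DualGeneric.symm {p q : ℂ} {n l m : ℕ} {z : Fin n → ℂ} {a : Fin l → ℂ} {w : Fin m → ℂ}
    {i : Fin l} (h : DualGeneric p q z a w i) :
    DualGeneric p q w (fun j => (a j)⁻¹) z i where
  card := by rw [h.card, add_comm]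
  left := h.right
  right := by
    rw [inv_inv]
    exact h.left
  ne_zero j := inv_ne_zero (h.ne_zero j)
  cross j k s := by
    rw [mul_comm (z j)]
    exact h.cross k j s
  balanced := by
    have := prod_ne_zero_iff.2 fun j (_ : j ∈ univ) => h.ne_zero j
    rw [prod_inv_distrib, h.balanced]
    field_simp

theorem prod_update_mul {n : ℕ} (z : Fin n → ℂ) (k : Fin n) (c : ℂ) :
    ∏ j, Function.update z k (z k * c) j = (∏ j, z j) * c := by
  rw [← mul_prod_erase univ _ (mem_univ k), ← mul_prod_erase univ z (mem_univ k),
    Function.update_self,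
    prod_congr rfl fun j hj => Function.update_of_ne (ne_of_mem_erase hj) (z k * c) z]
  ring

theorem DualGeneric.update {p q : ℂ} (hq : q ≠ 0) {n l m : ℕ} {z : Fin n → ℂ} {a : Fin l → ℂ}
    {w : Fin m → ℂ} {i : Fin l} (h : DualGeneric p q z a w i) (k : Fin n) :
    DualGeneric p q (Function.update z k (z k * q)) (Function.update a i (a i / q)) w i where
  card := h.card
  left := by
    rw [Function.update_self]
    exact h.left.update hq k
  right := by
    rw [Function.update_self]
    exact h.right.shift hq (fun _ => 0) 1 (fun j => by simp) (by rw [inv_div, zpow_one]; ring)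
  ne_zero j := by
    by_cases hj : j = i
    · rw [hj, Function.update_self]
      exact div_ne_zero (h.ne_zero i) hq
    · rw [Function.update_of_ne hj]
      exact h.ne_zero j
  cross j r s := by
    by_cases hr : r = k
    · subst hr
      have := h.cross j r (s + 1)
      rwa [zpow_add_one₀ hq, show q ^ s * q * (w j * z r) = q ^ s * (w j * (z r * q)) by ring,
        ← Function.update_self r (z r * q) z] at this
    · rw [Function.update_of_ne hr]
      exact h.cross j r s
  balanced := by
    rw [prod_update_mul, div_eq_mul_inv, prod_update_mul, h.balanced]
    field_simp

theorem prod_const_mul_fin {n : ℕ} (c : ℂ) (f : Fin n → ℂ) :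
    ∏ j, c * f j = c ^ n * ∏ j, f j := by
  rw [prod_mul_distrib, prod_const, card_univ, Fintype.card_fin]

/-- The case `N = 1` of the duality. Partial fractions at the `n + m` nodes `z_j, 1/w_j` with zeros
`1/a_j` split into the two sums. -/
theorem sum_recCoeff_zero {p q : ℂ} (hp : ‖p‖ < 1) {n l m : ℕ} {z : Fin n → ℂ}
    {a : Fin l → ℂ} {w : Fin m → ℂ} {i : Fin l} (h : DualGeneric p q z a w i) :
    ∑ k, recCoeff p q 0 z a w i k = ∑ k, recCoeff p q 0 w (fun j => (a j)⁻¹) z i k := by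
  have hz := h.left.ne_zero
  have hw := h.right.ne_zero
  have ha := h.ne_zero
  have hzz : ∀ j k, j ≠ k → theta p (z j / z k) ≠ 0 := fun j k hjk => by
    simpa using h.left.theta_div j k hjk 0
  have hww : ∀ j k, j ≠ k → theta p (w j / w k) ≠ 0 := fun j k hjk => by
    simpa using h.right.theta_div j k hjk 0
  have hwz : ∀ j k, theta p (w j * z k) ≠ 0 := fun j k => by simpa using h.cross j k 0
  have hrec : ∀ {n m : ℕ} (z : Fin n → ℂ) (a : Fin l → ℂ) (w : Fin m → ℂ) (k : Fin n),
      recCoeff p q 0 z a w i k = (theta p q)⁻¹ * ((∏ j, theta p (a j * z k)) /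
        ((∏ j, theta p (w j * z k)) * ∏ j ∈ univ.erase k, theta p (z k / z j))) := by
    intro n m z a w k
    rw [recCoeff, ← mul_prod_erase univ _ (mem_univ i), pow_zero, one_mul, zero_add, pow_one]
    ring
  simp only [hrec]
  rw [← mul_sum, ← mul_sum]
  congr 1
  let x : Fin n ⊕ Fin m → ℂ := Sum.elim z fun j => (w j)⁻¹
  have hinv : ∀ u v : ℂ, u ≠ 0 → v ≠ 0 → theta p (u⁻¹ / v) = -(v * u)⁻¹ * theta p (u * v) := by
    intro u v hu hv
    rw [mul_comm v, ← theta_inv hp (mul_ne_zero hu hv)]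
    congr 1
    field_simp
  have key := sum_prod_theta_div_eq_zero hp univ x
    (by
      rintro (j | j) -
      · exact hz j
      · exact inv_ne_zero (hw j))
    (by
      rintro (j | j) - (k | k) - hjk
      · exact hzz j k fun e => hjk (by rw [e])
      · change theta p (z j / (w k)⁻¹) ≠ 0
        rw [div_inv_eq_mul, mul_comm]
        exact hwz k j
      · change theta p ((w j)⁻¹ / z k) ≠ 0
        rw [hinv _ _ (hw j) (hz k)]
        exact mul_ne_zero (neg_ne_zero.2 (inv_ne_zero (mul_ne_zero (hz k) (hw j)))) (hwz j k)
      · have := hww k j fun e => hjk (by rw [e])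
        rwa [show w k / w j = x (Sum.inr j) / x (Sum.inr k) by
          simp only [x, Sum.elim_inr]
          rw [inv_div_inv]] at this)
    (univ.val.map fun j => (a j)⁻¹)
    (by
      intro y hy
      obtain ⟨j, -, rfl⟩ := Multiset.mem_map.1 hy
      exact inv_ne_zero (ha j))
    (by simp [h.card])
    (by
      change ∏ j, (a j)⁻¹ = _
      rw [Fintype.prod_sum_type]
      change _ = (∏ j, z j) * ∏ j, (w j)⁻¹
      have h₁ := prod_ne_zero_iff.2 fun j (_ : j ∈ univ) => ha j
      have h₂ := prod_ne_zero_iff.2 fun j (_ : j ∈ univ) => hz j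
      rw [prod_inv_distrib, prod_inv_distrib, h.balanced]
      field_simp)
  simp only [prod_erase_eq_ite] at key
  rw [Fintype.sum_sum_type] at key
  have hmap : ∀ c : ℂ, (Multiset.map (fun y => theta p (c / y))
      (univ.val.map fun j => (a j)⁻¹)).prod = ∏ j, theta p (c * a j) := by
    intro c
    rw [Multiset.map_map]
    simp only [Function.comp, div_inv_eq_mul]
    rfl
  simp only [hmap, Fintype.prod_sum_type, Sum.inl.injEq, Sum.inr.injEq, reduceCtorEq, if_false,
    x, Sum.elim_inl, Sum.elim_inr, div_inv_eq_mul] at key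
  simp only [← prod_erase_eq_ite] at key
  rw [add_eq_zero_iff_eq_neg, ← sum_neg_distrib] at key
  refine Eq.trans (sum_congr rfl fun k _ => ?_) (key.trans (sum_congr rfl fun k _ => ?_))
  · simp only [mul_comm (z k)]
    rw [mul_comm (∏ j, theta p (w j * z k))]
  · have hk := hw k
    have e₁ : ∏ j, theta p ((w k)⁻¹ * a j) =
        (-(w k)⁻¹) ^ l * (∏ j, a j) * ∏ j, theta p ((a j)⁻¹ * w k) := by
      rw [← prod_const_mul_fin, ← prod_mul_distrib]
      refine prod_congr rfl fun j _ => ?_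
      have := hinv (w k) (a j)⁻¹ hk (inv_ne_zero (ha j))
      rw [div_inv_eq_mul] at this
      rw [this, mul_comm (w k)]
      have := ha j
      field_simp
    have e₂ : ∏ j, theta p ((w k)⁻¹ / z j) =
        (-(w k)⁻¹) ^ n * (∏ j, z j)⁻¹ * ∏ j, theta p (z j * w k) := by
      rw [← prod_inv_distrib, ← prod_const_mul_fin, ← prod_mul_distrib]
      refine prod_congr rfl fun j _ => ?_
      rw [hinv _ _ hk (hz j), mul_comm (w k)]
      have := hz j
      field_simp
    -- The full product of the `-w_j/w_k` has the factor `-1` at `j = k`. Omitting it gives the sign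
    -- that cancels the one from moving this sum across the equation; the other monomials cancel by
    -- balancing and `l = n + m`.
    have e₃ : ∏ j ∈ univ.erase k, theta p ((w k)⁻¹ * w j) =
        -((-(w k)⁻¹) ^ m * ∏ j, w j) * ∏ j ∈ univ.erase k, theta p (w k / w j) := by
      have hc : -((-(w k)⁻¹) ^ m * ∏ j, w j) = ∏ j ∈ univ.erase k, (-(w k)⁻¹ * w j) := by
        rw [← prod_const_mul_fin, ← mul_prod_erase _ _ (mem_univ k)]
        field_simp
      rw [hc, ← prod_mul_distrib]
      refine prod_congr rfl fun j _ => ?_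
      have := hinv (w k) (w j)⁻¹ hk (inv_ne_zero (hw j))
      rw [div_inv_eq_mul] at this
      rw [this, div_eq_mul_inv (w k)]
      have := hw j
      field_simp
    have h₁ := prod_ne_zero_iff.2 fun j (_ : j ∈ univ) => ha j
    have h₂ := prod_ne_zero_iff.2 fun j (_ : j ∈ univ) => hz j
    have h₃ : ∏ j, theta p (z j * w k) ≠ 0 := prod_ne_zero_iff.2 fun j _ => by
      rw [mul_comm]
      exact hwz k j
    have h₄ : ∏ j ∈ univ.erase k, theta p (w k / w j) ≠ 0 :=
      prod_ne_zero_iff.2 fun j hj => hww k j (ne_of_mem_erase hj).symm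
    have h₅ : (-(w k)⁻¹) ≠ 0 := neg_ne_zero.2 (inv_ne_zero hk)
    have hl : (-(w k)⁻¹) ^ l = (-(w k)⁻¹) ^ n * (-(w k)⁻¹) ^ m := by rw [h.card, pow_add]
    rw [e₁, e₂, e₃, h.balanced, hl]
    generalize -(w k)⁻¹ = c at *
    field_simp

/-- Apart from the coefficient at level `N + 1`, the correction depends only on `N` and `w_r z_k`,
so it is unchanged when the roles of `z` and `w` are exchanged. -/
theorem recCoeff_update_mul {p q : ℂ} {N n l m : ℕ} {z : Fin n → ℂ} {a : Fin l → ℂ}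
    {w : Fin m → ℂ} {i : Fin l} (k : Fin n) (r : Fin m) (hq : theta p (q ^ (N + 1)) ≠ 0)
    (hq' : theta p (q ^ (N + 2)) ≠ 0)
    (hwz : theta p (w r * z k) ≠ 0) (hwz' : theta p (q * (w r * z k)) ≠ 0) :
    recCoeff p q N z (Function.update a i (a i * q)) (Function.update w r (w r * q)) i k =
      recCoeff p q (N + 1) z a w i k * (theta p (q ^ (N + 2)) * theta p (w r * z k) /
        (theta p (q ^ (N + 1)) * theta p (q * (w r * z k)))) := by
  rw [recCoeff, recCoeff, Function.update_self, ← mul_prod_erase univ _ (mem_univ r),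
    ← mul_prod_erase univ (fun j => theta p (w j * z k)) (mem_univ r), Function.update_self,
    show q ^ N * (a i * q * z k) = q ^ (N + 1) * (a i * z k) by ring,
    show w r * q * z k = q * (w r * z k) by ring,
    prod_congr rfl fun j hj => by rw [Function.update_of_ne (ne_of_mem_erase hj) (a i * q) a],
    prod_congr (s₁ := univ.erase r) rfl fun j hj => by
      rw [Function.update_of_ne (ne_of_mem_erase hj) (w r * q) w]]
  generalize theta p (w r * z k) = A at *
  generalize theta p (q * (w r * z k)) = B at *
  field_simp

/-- Duality between elliptic hypergeometric sums on `A_n` and on `A_m`, for generic parameters. -/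
theorem DualGeneric.ellSum_eq {p q : ℂ} (hp : ‖p‖ < 1) (hq : q ≠ 0) {N n l m : ℕ}
    (hqN : ∀ i, 1 ≤ i → i ≤ N → theta p (q ^ i) ≠ 0)
    {z : Fin n → ℂ} {a : Fin l → ℂ} {w : Fin m → ℂ} {i : Fin l} (h : DualGeneric p q z a w i) :
    ellSum p q N z a w = ellSum p q N w (fun j => (a j)⁻¹) z := by
  induction N using Nat.strong_induction_on generalizing n m z a w with
  | _ N ih =>
  rcases N with _ | _ | N
  · rw [ellSum_zero h.left.Delta_ne_zero, ellSum_zero h.right.Delta_ne_zero]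
  · rw [ellSum_succ hp hq hqN a w i h.left, ellSum_succ hp hq hqN _ z i h.right]
    rw [sum_congr rfl fun k _ => by
      rw [ellSum_zero (h.left.update hq k).Delta_ne_zero, mul_one]]
    rw [sum_recCoeff_zero hp h]
    refine sum_congr rfl fun k _ => ?_
    rw [ellSum_zero (h.right.update hq k).Delta_ne_zero, mul_one]
  · have hinv : ∀ (b : Fin l → ℂ) (c : ℂ), (fun j => (Function.update b i c j)⁻¹) =
        Function.update (fun j => (b j)⁻¹) i c⁻¹ := by
      intro b c
      funext j
      by_cases hj : j = i
      · subst hj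
        simp
      · simp [hj]
    have hqN₁ : ∀ i, 1 ≤ i → i ≤ N + 1 → theta p (q ^ i) ≠ 0 :=
      fun i h₁ h₂ => hqN i h₁ (by omega)
    have hqN₀ : ∀ i, 1 ≤ i → i ≤ N → theta p (q ^ i) ≠ 0 := fun i h₁ h₂ => hqN i h₁ (by omega)
    -- One step of the recursion, seen from the dual side: dualise at level `N + 1`, then expand in
    -- the nodes `w`. The parameter `1/(a_i/q)` returns to `1/a_i`.
    have hstep : ∀ {n m : ℕ} {z : Fin n → ℂ} {a : Fin l → ℂ} {w : Fin m → ℂ},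
        DualGeneric p q z a w i → ∀ k, ellSum p q (N + 1) (Function.update z k (z k * q))
        (Function.update a i (a i / q)) w = ∑ r, recCoeff p q N w
          (Function.update (fun j => (a j)⁻¹) i ((a i)⁻¹ * q)) (Function.update z k (z k * q)) i r *
          ellSum p q N (Function.update w r (w r * q)) (fun j => (a j)⁻¹)
            (Function.update z k (z k * q)) := by
      intro n m z a w h k
      have h' := h.update hq k
      rw [ih (N + 1) (by omega) hqN₁ h', ellSum_succ hp hq hqN₁ _ _ i h'.right]
      refine sum_congr rfl fun r _ => ?_
      have e : (a i / q)⁻¹ = (a i)⁻¹ * q := by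
        rw [inv_div, div_eq_inv_mul]
      simp only [Function.update_self]
      rw [hinv, Function.update_idem, e, mul_div_cancel_right₀ _ hq,
        Function.update_eq_self i (fun j => (a j)⁻¹)]
    have hL := hstep h
    have hR := hstep h.symm
    rw [ellSum_succ hp hq hqN a w i h.left, ellSum_succ hp hq hqN _ z i h.right]
    simp only [hL, hR, mul_sum]
    rw [sum_comm]
    refine sum_congr rfl fun r _ => sum_congr rfl fun k _ => ?_
    simp only [inv_inv]
    have hg : DualGeneric p q (Function.update z k (z k * q)) a (Function.update w r (w r * q)) i := by
      have h₁ := ((h.update hq k).symm.update hq r).symm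
      convert h₁ using 1
      funext j
      by_cases hj : j = i
      · subst hj
        simp only [Function.update_self]
        field_simp
      · simp [hj]
    -- The inner sums agree by duality at level `N`; the remaining products of two coefficients
    -- agree by symmetry of the correction factor.
    rw [ih N (by omega) hqN₀ hg]
    have hq₁ := hqN₁ (N + 1) (by omega) le_rfl
    have hq₂ := hqN (N + 2) (by omega) le_rfl
    have h₁ : theta p (w r * z k) ≠ 0 := by simpa using h.cross r k 0
    have h₂ : theta p (q * (w r * z k)) ≠ 0 := by simpa using h.cross r k 1
    rw [recCoeff_update_mul k r hq₁ hq₂ h₁ h₂]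
    rw [mul_comm (w r)] at h₁ h₂
    rw [recCoeff_update_mul r k hq₁ hq₂ h₁ h₂, mul_comm (w r)]
    ring_nf

end

/-! ### Reversal and the swap for generic parameters -/

section

open Finset Filter Topology MeasureTheory

theorem poch_ne_zero_of_le {p q a : ℂ} {k N : ℕ} (hk : k ≤ N) (h : poch p q a N ≠ 0) :
    poch p q a k ≠ 0 :=
  prod_ne_zero_iff.2 fun i hi =>
    prod_ne_zero_iff.1 h i (mem_range.2 ((mem_range.1 hi).trans_le hk))

theorem poch_ne_zero {p q a : ℂ} (h : ∀ s : ℤ, theta p (q ^ s * a) ≠ 0) (N : ℕ) :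
    poch p q a N ≠ 0 :=
  prod_ne_zero_iff.2 fun i _ => by
    have := h i
    rwa [zpow_natCast, mul_comm] at this

/-- The arguments of the first symbol are the inverses of those of the last `k` factors of
`(c)_{k+l}`, so theta inversion applies factor by factor. -/
theorem poch_reverse {p q : ℂ} (hp : ‖p‖ < 1) (hq : q ≠ 0) {c : ℂ} (hc : c ≠ 0) (k l : ℕ) :
    poch p q (q ^ (1 - ((k + l : ℕ) : ℤ)) / c) k * poch p q c l =
      poch p q c (k + l) * ((∏ i ∈ range k, -q ^ (1 - ((k + l : ℕ) : ℤ) + i)) * (c ^ k)⁻¹) := by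
  obtain ⟨N, hN⟩ : ∃ N, k + l = N := ⟨_, rfl⟩
  rw [hN]
  induction k generalizing l with
  | zero =>
    rw [zero_add] at hN
    simp [poch_zero, hN]
  | succ k ih =>
    have h := ih (l + 1) (by omega)
    have hθ : theta p (q ^ (1 - (N : ℤ)) / c * q ^ k) =
        -q ^ (1 - (N : ℤ) + k) * c⁻¹ * theta p (c * q ^ l) := by
      have hl : q ^ (1 - (N : ℤ) + k) = (q ^ l)⁻¹ := by
        rw [← zpow_natCast q l, ← zpow_neg]
        congr 1
        omega
      have h₁ := theta_inv hp (mul_ne_zero hc (pow_ne_zero l hq))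
      rw [hl, show q ^ (1 - (N : ℤ)) / c * q ^ k = (c * q ^ l)⁻¹ by
        rw [mul_inv, ← hl, zpow_add₀ hq, zpow_natCast]
        ring, h₁, mul_inv]
      ring
    rw [poch_succ p q c l] at h
    rw [poch_succ, prod_range_succ, hθ, pow_succ, mul_inv]
    linear_combination (-q ^ (1 - (N : ℤ) + k) * c⁻¹) * h

/-- Since `k + l = N`, reversal turns each symbol of index `k` in `w₁` into one of index `l` in
`w₂`, and conversely. The signs and powers of `q` cancel between numerator and denominator, leaving
`(αζ)^N`. -/
theorem poch_swap {p q : ℂ} (hp : ‖p‖ < 1) (hq : q ≠ 0) {α ζ w₁ w₂ : ℂ} (hα : α ≠ 0) (hζ : ζ ≠ 0)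
    (hw₁ : w₁ ≠ 0) (hw₂ : w₂ ≠ 0) {N k l : ℕ} (hN : k + l = N)
    (h₁ : poch p q (w₁ * ζ) N ≠ 0) (h₂ : poch p q (w₂ * ζ) N ≠ 0)
    (h₃ : poch p q (w₁ / α) N ≠ 0) (h₄ : poch p q (w₂ / α) N ≠ 0) :
    poch p q (α⁻¹ * w₁) k * poch p q (α⁻¹ * w₂) l / (poch p q (ζ * w₁) k * poch p q (ζ * w₂) l) =
      (α * ζ) ^ N * poch p q (w₁ / α) N * poch p q (w₂ / α) N /
          (poch p q (w₁ * ζ) N * poch p q (w₂ * ζ) N) *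
        (poch p q ((q ^ ((N : ℤ) - 1) * w₁ * w₂ * ζ)⁻¹ * w₁) k *
            poch p q ((q ^ ((N : ℤ) - 1) * w₁ * w₂ * ζ)⁻¹ * w₂) l /
          (poch p q (q ^ (1 - (N : ℤ)) * α / (w₁ * w₂) * w₁) k *
            poch p q (q ^ (1 - (N : ℤ)) * α / (w₁ * w₂) * w₂) l)) := by
  have hz : q ^ (1 - (N : ℤ)) = (q ^ ((N : ℤ) - 1))⁻¹ := by
    rw [← zpow_neg]
    congr 1
    ring
  have hQ : q ^ ((N : ℤ) - 1) ≠ 0 := zpow_ne_zero _ hq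
  have hN' : l + k = N := by omega
  have r₁ := poch_reverse hp hq (mul_ne_zero hw₂ hζ) k l
  have r₂ := poch_reverse hp hq (mul_ne_zero hw₁ hζ) l k
  have r₃ := poch_reverse hp hq (div_ne_zero hw₂ hα) k l
  have r₄ := poch_reverse hp hq (div_ne_zero hw₁ hα) l k
  rw [hN] at r₁ r₃
  rw [hN'] at r₂ r₄
  have e₁ : (q ^ ((N : ℤ) - 1) * w₁ * w₂ * ζ)⁻¹ * w₁ = q ^ (1 - (N : ℤ)) / (w₂ * ζ) := by
    rw [hz]
    field_simp
  have e₂ : (q ^ ((N : ℤ) - 1) * w₁ * w₂ * ζ)⁻¹ * w₂ = q ^ (1 - (N : ℤ)) / (w₁ * ζ) := by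
    rw [hz]
    field_simp
  have e₃ : q ^ (1 - (N : ℤ)) * α / (w₁ * w₂) * w₁ = q ^ (1 - (N : ℤ)) / (w₂ / α) := by
    field_simp
  have e₄ : q ^ (1 - (N : ℤ)) * α / (w₁ * w₂) * w₂ = q ^ (1 - (N : ℤ)) / (w₁ / α) := by
    field_simp
  have hM : ∀ k : ℕ, ∏ i ∈ range k, -q ^ (1 - (N : ℤ) + i) ≠ 0 := fun k =>
    prod_ne_zero_iff.2 fun i _ => neg_ne_zero.2 (zpow_ne_zero _ hq)
  have hMk := hM k
  have hMl := hM l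
  have hk : k ≤ N := by omega
  have hl : l ≤ N := by omega
  have n₁ := poch_ne_zero_of_le hk h₁
  have n₂ := poch_ne_zero_of_le hl h₂
  have n₃ := poch_ne_zero_of_le hk h₃
  have n₄ := poch_ne_zero_of_le hl h₄
  rw [e₁, e₂, e₃, e₄, mul_comm ζ, mul_comm ζ, ← div_eq_inv_mul, ← div_eq_inv_mul,
    eq_div_of_mul_eq n₂ r₁, eq_div_of_mul_eq n₁ r₂, eq_div_of_mul_eq n₄ r₃,
    eq_div_of_mul_eq n₃ r₄, ← hN, pow_add]
  rw [← hN] at h₁ h₂ h₃ h₄ hMk hMl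
  generalize poch p q (w₁ * ζ) (k + l) = A₁ at *
  generalize poch p q (w₂ * ζ) (k + l) = A₂ at *
  generalize poch p q (w₁ / α) (k + l) = A₃ at *
  generalize poch p q (w₂ / α) (k + l) = A₄ at *
  generalize poch p q (w₁ * ζ) k = B₁ at *
  generalize poch p q (w₂ * ζ) l = B₂ at *
  generalize poch p q (w₁ / α) k = B₃ at *
  generalize poch p q (w₂ / α) l = B₄ at *
  generalize ∏ i ∈ range k, -q ^ (1 - ((k + l : ℕ) : ℤ) + i) = M₁ at *
  generalize ∏ i ∈ range l, -q ^ (1 - ((k + l : ℕ) : ℤ) + i) = M₂ at *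
  simp only [mul_pow, div_pow]
  field_simp

theorem bParam_castAdd {q : ℂ} {N n m : ℕ} (z : Fin n → ℂ) (a : Fin (n + 2) → ℂ) (w₁ w₂ : ℂ)
    (j : Fin n) : bParam q N m z a w₁ w₂ (Fin.castAdd 2 j) =
      if (j : ℕ) < n - m then q ^ ((N : ℤ) - 1) * w₁ * w₂ * z j else a (Fin.castAdd 2 j) := by
  by_cases h : (j : ℕ) < n - m <;> simp [bParam, h]

theorem bParam_natAdd {q : ℂ} {N n m : ℕ} (z : Fin n → ℂ) (a : Fin (n + 2) → ℂ) (w₁ w₂ : ℂ)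
    (j : Fin 2) : bParam q N m z a w₁ w₂ (Fin.natAdd n j) = a (Fin.natAdd n j) := by
  have : ¬ ((Fin.natAdd n j : Fin (n + 2)) : ℕ) < n - m := by
    rw [Fin.val_natAdd]
    omega
  rw [bParam, dif_neg this]

theorem prod_xParam_mul_prod_bParam {q : ℂ} (hq : q ≠ 0) {N n m : ℕ} (z : Fin n → ℂ)
    (a : Fin (n + 2) → ℂ) {w₁ w₂ : ℂ} (hw₁ : w₁ ≠ 0) (hw₂ : w₂ ≠ 0) :
    (∏ j, xParam q N m z a w₁ w₂ j) * ∏ j, bParam q N m z a w₁ w₂ j = (∏ j, z j) * ∏ j, a j := by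
  rw [Fin.prod_univ_add, Fin.prod_univ_add (f := a), ← mul_assoc, ← mul_assoc, ← prod_mul_distrib,
    ← prod_mul_distrib]
  congr 1
  · refine prod_congr rfl fun j _ => ?_
    rw [bParam_castAdd, xParam]
    split_ifs
    · have hz : q ^ (1 - (N : ℤ)) = (q ^ ((N : ℤ) - 1))⁻¹ := by
        rw [← zpow_neg]
        congr 1
        ring
      have hQ : q ^ ((N : ℤ) - 1) ≠ 0 := zpow_ne_zero _ hq
      rw [hz]
      field_simp
    · rfl
  · exact prod_congr rfl fun j _ => bParam_natAdd z a w₁ w₂ j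

/-- The swap transformation for generic parameters. -/
theorem ellSum_swap_of_generic {p q : ℂ} (hp : ‖p‖ < 1) (hq : q ≠ 0) {N n m : ℕ}
    (hqN : ∀ i, 1 ≤ i → i ≤ N → theta p (q ^ i) ≠ 0) {z : Fin n → ℂ} {a : Fin (n + 2) → ℂ}
    {w₁ w₂ : ℂ} {i i' : Fin (n + 2)} (h : DualGeneric p q z a ![w₁, w₂] i)
    (h' : DualGeneric p q (xParam q N m z a w₁ w₂) (bParam q N m z a w₁ w₂) ![w₁, w₂] i') :
    ellSum p q N z a ![w₁, w₂] =
      (∏ j ∈ univ.filter (fun j : Fin n => (j : ℕ) < n - m),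
        (a (Fin.castAdd 2 j) * z j) ^ N * poch p q (w₁ / a (Fin.castAdd 2 j)) N *
          poch p q (w₂ / a (Fin.castAdd 2 j)) N / (poch p q (w₁ * z j) N * poch p q (w₂ * z j) N)) *
      ellSum p q N (xParam q N m z a w₁ w₂) (bParam q N m z a w₁ w₂) ![w₁, w₂] := by
  have hw₁ : w₁ ≠ 0 := h.right.ne_zero 0
  have hw₂ : w₂ ≠ 0 := h.right.ne_zero 1
  have hz := h.left.ne_zero
  have ha := h.ne_zero
  have hc₁ : ∀ j, poch p q (w₁ * z j) N ≠ 0 := fun j => poch_ne_zero (h.cross 0 j) N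
  have hc₂ : ∀ j, poch p q (w₂ * z j) N ≠ 0 := fun j => poch_ne_zero (h.cross 1 j) N
  have hinv : ∀ {u v : ℂ}, u ≠ 0 → v ≠ 0 → (∀ s : ℤ, theta p (q ^ s * (v / u)) ≠ 0) →
      ∀ s : ℤ, theta p (q ^ s * (u / v)) ≠ 0 := by
    intro u v hu hv hs s
    have hne : q ^ (-s) * (v / u) ≠ 0 := mul_ne_zero (zpow_ne_zero _ hq) (div_ne_zero hv hu)
    rw [show q ^ s * (u / v) = (q ^ (-s) * (v / u))⁻¹ by rw [zpow_neg, mul_inv, inv_inv, inv_div],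
      theta_inv hp hne]
    exact mul_ne_zero (neg_ne_zero.2 (inv_ne_zero hne)) (hs _)
  have hx : ∀ j : Fin n, (j : ℕ) < n - m →
      xParam q N m z a w₁ w₂ j = q ^ (1 - (N : ℤ)) * a (Fin.castAdd 2 j) / (w₁ * w₂) :=
    fun j hj => if_pos hj
  have hc₃ : ∀ j : Fin n, (j : ℕ) < n - m → poch p q (w₁ / a (Fin.castAdd 2 j)) N ≠ 0 := by
    intro j hj
    refine poch_ne_zero (hinv hw₁ (ha _) fun s => ?_) N
    -- `w₂ x_j = q^(1-N) a_j/w₁`, so nonvanishing for `w₁/a_j` comes from the other parameter `w₂`;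
    -- the exponent compensates for `q^(1-N)`.
    have := h'.cross 1 j (s - (1 - N))
    rw [hx j hj, zpow_sub₀ hq] at this
    convert! this using 2
    have := zpow_ne_zero (1 - (N : ℤ)) hq
    simp only [Matrix.cons_val_one, Matrix.cons_val_zero]
    field_simp
  have hc₄ : ∀ j : Fin n, (j : ℕ) < n - m → poch p q (w₂ / a (Fin.castAdd 2 j)) N ≠ 0 := by
    intro j hj
    refine poch_ne_zero (hinv hw₂ (ha _) fun s => ?_) N
    have := h'.cross 0 j (s - (1 - N))
    rw [hx j hj, zpow_sub₀ hq] at this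
    convert! this using 2
    have := zpow_ne_zero (1 - (N : ℤ)) hq
    simp only [Matrix.cons_val_zero]
    field_simp
  rw [h.ellSum_eq hp hq hqN, h'.ellSum_eq hp hq hqN, ellSum, ellSum, mul_sum]
  refine sum_congr rfl fun y hy => ?_
  have hN : y 0 + y 1 = N := by
    have := (mem_piAntidiag.1 hy).1
    rwa [Fin.sum_univ_two] at this
  have key : ∏ j : Fin n, (∏ k : Fin 2, poch p q ((a (Fin.castAdd 2 j))⁻¹ * ![w₁, w₂] k) (y k)) /
      (∏ k : Fin 2, poch p q (z j * ![w₁, w₂] k) (y k)) =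
      (∏ j ∈ univ.filter (fun j : Fin n => (j : ℕ) < n - m),
        (a (Fin.castAdd 2 j) * z j) ^ N * poch p q (w₁ / a (Fin.castAdd 2 j)) N *
          poch p q (w₂ / a (Fin.castAdd 2 j)) N / (poch p q (w₁ * z j) N * poch p q (w₂ * z j) N)) *
      ∏ j : Fin n, (∏ k : Fin 2, poch p q ((if (j : ℕ) < n - m then
        q ^ ((N : ℤ) - 1) * w₁ * w₂ * z j else a (Fin.castAdd 2 j))⁻¹ * ![w₁, w₂] k) (y k)) /
      (∏ k : Fin 2, poch p q (xParam q N m z a w₁ w₂ j * ![w₁, w₂] k) (y k)) := by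
    rw [prod_filter, ← prod_mul_distrib]
    refine prod_congr rfl fun j _ => ?_
    simp only [Fin.prod_univ_two, Matrix.cons_val_zero, Matrix.cons_val_one]
    by_cases hj : (j : ℕ) < n - m
    · rw [if_pos hj, if_pos hj, hx j hj]
      exact poch_swap hp hq (ha _) (hz j) hw₁ hw₂ hN (hc₁ j) (hc₂ j) (hc₃ j hj) (hc₄ j hj)
    · rw [if_neg hj, if_neg hj, xParam, if_neg hj, one_mul]
  have num : ∀ c : Fin (n + 2) → ℂ,
      ∏ k : Fin 2, ∏ j, poch p q ((c j)⁻¹ * ![w₁, w₂] k) (y k) =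
        (∏ j : Fin n, ∏ k : Fin 2, poch p q ((c (Fin.castAdd 2 j))⁻¹ * ![w₁, w₂] k) (y k)) *
          ∏ j : Fin 2, ∏ k : Fin 2, poch p q ((c (Fin.natAdd n j))⁻¹ * ![w₁, w₂] k) (y k) := by
    intro c
    rw [Finset.prod_comm, Fin.prod_univ_add]
  have den : ∀ c : Fin n → ℂ, ∏ k : Fin 2, ∏ j, poch p q (c j * ![w₁, w₂] k) (y k) =
      ∏ j, ∏ k : Fin 2, poch p q (c j * ![w₁, w₂] k) (y k) := fun c => Finset.prod_comm
  generalize ∏ j ∈ univ.filter (fun j : Fin n => (j : ℕ) < n - m),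
        (a (Fin.castAdd 2 j) * z j) ^ N * poch p q (w₁ / a (Fin.castAdd 2 j)) N *
          poch p q (w₂ / a (Fin.castAdd 2 j)) N /
            (poch p q (w₁ * z j) N * poch p q (w₂ * z j) N) = P at *
  rw [prod_div_distrib, prod_div_distrib] at key
  rw [prod_div_distrib, prod_div_distrib, prod_mul_distrib, prod_mul_distrib, num, num, den, den]
  simp only [bParam_castAdd, bParam_natAdd]
  generalize ∏ k : Fin 2, ∏ j : Fin 2, poch p q (q * ![w₁, w₂] k / ![w₁, w₂] j) (y k) = D
  generalize ∏ j : Fin 2, ∏ k : Fin 2,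
    poch p q ((a (Fin.natAdd n j))⁻¹ * ![w₁, w₂] k) (y k) = E
  generalize Delta p (fun k => ![w₁, w₂] k * q ^ y k) / Delta p ![w₁, w₂] = F
  linear_combination (F * E / D) * key

end

/-! ### Deformation of parameters and continuity -/

section

open Finset Filter Topology MeasureTheory

/-- Theta has countably many nonzero zeros, and an injective curve meets a countable set at
countably many, hence almost no, times. -/
theorem ae_theta_ne_zero {p q : ℂ} (hp : ‖p‖ < 1) (hq : q ≠ 0) {c : ℂ} (hc : c ≠ 0) {r : ℝ}
    (hr : r ≠ 0) :
    ∀ᵐ t : ℝ, ∀ s : ℤ, theta p (q ^ s * (c * (Real.exp (r * t) : ℂ))) ≠ 0 := by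
  rw [ae_all_iff]
  intro s
  have hinj : Function.Injective fun t : ℝ => q ^ s * (c * (Real.exp (r * t) : ℂ)) := by
    intro t t' h
    have h₁ := mul_left_cancel₀ hc (mul_left_cancel₀ (zpow_ne_zero s hq) h)
    exact mul_left_cancel₀ hr (Real.exp_injective (Complex.ofReal_injective h₁))
  have hcount := (countable_theta_eq_zero hp).preimage hinj
  filter_upwards [hcount.ae_notMem volume] with t ht h
  refine ht ⟨?_, h⟩
  exact mul_ne_zero (zpow_ne_zero s hq)
    (mul_ne_zero hc (Complex.ofReal_ne_zero.2 (Real.exp_ne_zero _)))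

/-- The point `c` moved along the curve `t ↦ c e^(r t)`. -/
def expCurve (c : ℂ) (r t : ℝ) : ℂ := c * (Real.exp (r * t) : ℂ)

theorem expCurve_zero (c : ℂ) (r : ℝ) : expCurve c r 0 = c := by simp [expCurve]

theorem expCurve_ne_zero {c : ℂ} (hc : c ≠ 0) (r t : ℝ) : expCurve c r t ≠ 0 :=
  mul_ne_zero hc (Complex.ofReal_ne_zero.2 (Real.exp_ne_zero _))

theorem continuous_expCurve (c : ℂ) (r : ℝ) : Continuous (expCurve c r) := by
  unfold expCurve
  fun_prop

theorem expCurve_mul (c d : ℂ) (r s t : ℝ) :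
    expCurve c r t * expCurve d s t = expCurve (c * d) (r + s) t := by
  simp only [expCurve, add_mul, Real.exp_add, Complex.ofReal_mul]
  ring

theorem expCurve_inv (c : ℂ) (r t : ℝ) : (expCurve c r t)⁻¹ = expCurve c⁻¹ (-r) t := by
  simp only [expCurve, neg_mul, Real.exp_neg, Complex.ofReal_inv, mul_inv]

theorem expCurve_div (c d : ℂ) (r s t : ℝ) :
    expCurve c r t / expCurve d s t = expCurve (c / d) (r - s) t := by
  rw [div_eq_mul_inv, expCurve_inv, expCurve_mul, div_eq_mul_inv, sub_eq_add_neg]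

theorem prod_expCurve {ι : Type*} (s : Finset ι) (c : ι → ℂ) (r : ι → ℝ) (t : ℝ) :
    ∏ j ∈ s, expCurve (c j) (r j) t = expCurve (∏ j ∈ s, c j) (∑ j ∈ s, r j) t := by
  simp only [expCurve, prod_mul_distrib, sum_mul, Real.exp_sum, Complex.ofReal_prod]

theorem ae_genericNodes {p q : ℂ} (hp : ‖p‖ < 1) (hq : q ≠ 0) {n : ℕ} {z : Fin n → ℂ} {c : ℂ}
    (hz : ∀ j, z j ≠ 0) (hc : c ≠ 0) {e : Fin n → ℝ} {g : ℝ} (he : Function.Injective e)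
    (hg : ∀ k, g + e k ≠ 0) :
    ∀ᵐ t : ℝ, GenericNodes p q (fun j => expCurve (z j) (e j) t) (expCurve c g t) := by
  have h₁ : ∀ᵐ t : ℝ, ∀ j k, j ≠ k → ∀ s : ℤ,
      theta p (q ^ s * expCurve (z j / z k) (e j - e k) t) ≠ 0 := by
    simp only [ae_all_iff]
    intro j k hjk
    have := ae_theta_ne_zero hp hq (div_ne_zero (hz j) (hz k))
      (sub_ne_zero.2 fun h => hjk (he h))
    exact ae_all_iff.1 this
  have h₂ : ∀ᵐ t : ℝ, ∀ k, ∀ s : ℤ, theta p (q ^ s * expCurve (c * z k) (g + e k) t) ≠ 0 := by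
    rw [ae_all_iff]
    intro k
    exact ae_theta_ne_zero hp hq (mul_ne_zero hc (hz k)) (hg k)
  filter_upwards [h₁, h₂] with t h₁ h₂
  refine ⟨fun j => expCurve_ne_zero (hz j) _ _, expCurve_ne_zero hc _ _, fun j k hjk s => ?_,
    fun k s => ?_⟩
  · rw [expCurve_div]
    exact h₁ j k hjk s
  · rw [expCurve_mul]
    exact h₂ k s

theorem ae_cross {p q : ℂ} (hp : ‖p‖ < 1) (hq : q ≠ 0) {n m : ℕ} {z : Fin n → ℂ} {w : Fin m → ℂ}
    (hz : ∀ j, z j ≠ 0) (hw : ∀ j, w j ≠ 0) {e : Fin n → ℝ} {f : Fin m → ℝ}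
    (hfe : ∀ j k, f j + e k ≠ 0) :
    ∀ᵐ t : ℝ, ∀ j k, ∀ s : ℤ,
      theta p (q ^ s * (expCurve (w j) (f j) t * expCurve (z k) (e k) t)) ≠ 0 := by
  rw [ae_all_iff]
  intro j
  rw [ae_all_iff]
  intro k
  simp only [expCurve_mul]
  exact ae_theta_ne_zero hp hq (mul_ne_zero (hw j) (hz k)) (hfe j k)

theorem continuousAt_poch {p q : ℂ} (hp : ‖p‖ < 1) (hq : q ≠ 0) {f : ℝ → ℂ} {t : ℝ}
    (hf : ContinuousAt f t) (hne : f t ≠ 0) (k : ℕ) :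
    ContinuousAt (fun t => poch p q (f t) k) t := by
  unfold EllipticHyp.poch
  refine tendsto_finsetProd _ fun i _ => ?_
  exact ContinuousAt.comp (f := fun t => f t * q ^ i)
    (continuousAt_theta hp (mul_ne_zero hne (pow_ne_zero i hq))) (hf.mul continuousAt_const)

theorem continuousAt_Delta {p : ℂ} (hp : ‖p‖ < 1) {n : ℕ} {z : ℝ → Fin n → ℂ} {t : ℝ}
    (hz : ∀ j, ContinuousAt (fun t => z t j) t) (hne : ∀ j, z t j ≠ 0) :
    ContinuousAt (fun t => Delta p (z t)) t := by
  unfold EllipticHyp.Delta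
  refine tendsto_finsetProd _ fun j _ => tendsto_finsetProd _ fun k _ => ?_
  exact (hz j).mul (ContinuousAt.comp (f := fun t => z t k / z t j)
    (continuousAt_theta hp (div_ne_zero (hne k) (hne j))) ((hz k).div (hz j) (hne j)))

theorem continuousAt_ellSum {p q : ℂ} (hp : ‖p‖ < 1) (hq : q ≠ 0) {N n l m : ℕ}
    {z : ℝ → Fin n → ℂ} {a : ℝ → Fin l → ℂ} {w : ℝ → Fin m → ℂ} {t : ℝ}
    (hz : ∀ j, ContinuousAt (fun t => z t j) t) (ha : ∀ j, ContinuousAt (fun t => a t j) t)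
    (hw : ∀ j, ContinuousAt (fun t => w t j) t) (hz0 : ∀ j, z t j ≠ 0) (ha0 : ∀ j, a t j ≠ 0)
    (hw0 : ∀ j, w t j ≠ 0) (hadm : Admissible p q N (z t) (w t)) :
    ContinuousAt (fun t => ellSum p q N (z t) (a t) (w t)) t := by
  obtain ⟨hΔ, hwz, hzz⟩ := hadm
  unfold EllipticHyp.ellSum
  refine tendsto_finsetSum _ fun y hy => ?_
  have hle : ∀ k, y k ≤ N := fun k =>
    (mem_piAntidiag.1 hy).1 ▸ single_le_sum (fun _ _ => Nat.zero_le _) (mem_univ k)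
  refine Tendsto.mul (ContinuousAt.div (continuousAt_Delta hp (z := fun t k => z t k * q ^ y k)
    (fun j => (hz j).mul continuousAt_const) fun j => mul_ne_zero (hz0 j) (pow_ne_zero _ hq))
    (continuousAt_Delta hp hz hz0) hΔ) (tendsto_finsetProd _ fun k _ => ?_)
  refine ContinuousAt.div (tendsto_finsetProd _ fun j _ => ?_)
    (Tendsto.mul (tendsto_finsetProd _ fun j _ => ?_) (tendsto_finsetProd _ fun j _ => ?_)) ?_
  · exact continuousAt_poch hp hq ((ha j).mul (hz k)) (mul_ne_zero (ha0 j) (hz0 k)) _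
  · exact continuousAt_poch hp hq ((hw j).mul (hz k)) (mul_ne_zero (hw0 j) (hz0 k)) _
  · exact continuousAt_poch hp hq ((continuousAt_const.mul (hz k)).div (hz j) (hz0 j))
      (div_ne_zero (mul_ne_zero hq (hz0 k)) (hz0 j)) _
  · exact mul_ne_zero (prod_ne_zero_iff.2 fun j _ => poch_ne_zero_of_le (hle k) (hwz k j))
      (prod_ne_zero_iff.2 fun j _ => poch_ne_zero_of_le (hle k) (hzz k j))

/-- A set of full Lebesgue measure is dense, so `t` is a limit of points of equality. -/
theorem eq_of_ae_eq_of_continuousAt {f g : ℝ → ℂ} {t : ℝ} (hf : ContinuousAt f t)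
    (hg : ContinuousAt g t) (h : ∀ᵐ s, f s = g s) : f t = g t := by
  have hd : ∃ᶠ s in 𝓝 t, f s = g s :=
    mem_closure_iff_frequently.1 ((Measure.dense_of_ae h) t)
  have hz : f t - g t ∈ ({0} : Set ℂ) :=
    isClosed_singleton.mem_of_frequently_of_tendsto
      (hd.mono fun s hs => Set.mem_singleton_iff.2 (sub_eq_zero.2 hs)) (hf.sub hg)
  exact sub_eq_zero.1 hz

end

/-! ### Choice of the deformation exponents -/

section

open Finset Filter Topology MeasureTheory

/-- The sum of the exponents `j + 1` along which the parameters are deformed. -/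
def expSum (n : ℕ) : ℕ := ∑ j : Fin n, ((j : ℕ) + 1) + ∑ j : Fin (n + 2), ((j : ℕ) + 1)

/-- Large enough that the swapped exponents `j + 1 - expSum n` are negative and stay nonzero after
adding `n + 2`, the exponent of the last `a`. -/
theorem two_mul_add_three_le_expSum (n : ℕ) : 2 * n + 3 ≤ expSum n := by
  rw [expSum, Fin.sum_univ_castSucc (n := n + 1), Fin.sum_univ_castSucc (n := n)]
  simp only [Fin.val_last, Fin.val_castSucc]
  omega

/-- The exponents along which `xParam` is deformed. -/
def xExponent (n m : ℕ) (j : Fin n) : ℤ :=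
  if (j : ℕ) < n - m then (j : ℤ) + 1 - expSum n else j + 1

theorem xParam_expCurve {q : ℂ} {N n m : ℕ} (z : Fin n → ℂ) (a : Fin (n + 2) → ℂ) (w₁ w₂ : ℂ)
    (r₁ r₂ : ℝ) (hr : r₁ + r₂ = expSum n) (t : ℝ) :
    xParam q N m (fun j => expCurve (z j) ((j : ℝ) + 1) t)
      (fun j => expCurve (a j) ((j : ℝ) + 1) t) (expCurve w₁ r₁ t) (expCurve w₂ r₂ t) =
      fun j => expCurve (xParam q N m z a w₁ w₂ j) (xExponent n m j : ℤ) t := by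
  funext j
  rw [xParam, xParam, xExponent]
  split_ifs
  · rw [expCurve_mul, hr, mul_div_assoc, expCurve_div, mul_div_assoc, Fin.val_castAdd]
    push_cast
    rw [expCurve, expCurve, mul_assoc]
  · push_cast
    rfl

theorem xExponent_injective (n m : ℕ) : Function.Injective (xExponent n m) := by
  intro j k h
  have hT := two_mul_add_three_le_expSum n
  have hj := j.isLt
  have hk := k.isLt
  unfold xExponent at h
  ext
  split_ifs at h <;> omega

theorem add_xExponent_ne_zero (n m : ℕ) (j : Fin n) : (n : ℤ) + 2 + xExponent n m j ≠ 0 := by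
  have hT := two_mul_add_three_le_expSum n
  have hj := j.isLt
  unfold xExponent
  split_ifs <;> omega

/-- The parameters `w` move with half-integer exponents and everything else with integer ones, so
their exponents never cancel. -/
theorem half_add_intCast_ne_zero (k : ℤ) : (1 / 2 : ℝ) + k ≠ 0 := by
  intro h
  have h₁ : ((1 + 2 * k : ℤ) : ℝ) = 0 := by
    push_cast
    linarith
  have := Int.cast_eq_zero.1 h₁
  omega

end

end EllipticHyp

end

/-! ### The transformation for all admissible parameters -/

open Finset Filter Topology MeasureTheory EllipticHyp in
theorem corollary4p1 (p q : ℂ) (hp : ‖p‖ < 1) (hq : q ≠ 0) (n m N : ℕ) (hm : m ≤ n)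
    (z : Fin n → ℂ) (a : Fin (n + 2) → ℂ) (w₁ w₂ : ℂ)
    (hz : ∀ j, z j ≠ 0) (ha : ∀ j, a j ≠ 0)
    (hbal : w₁ * w₂ = (∏ j, z j) * ∏ j, a j)
    (hadm : EllipticHyp.Admissible p q N z ![w₁, w₂])
    (hadm' : EllipticHyp.Admissible p q N (EllipticHyp.xParam q N m z a w₁ w₂) ![w₁, w₂]) :
    EllipticHyp.ellSum p q N z a ![w₁, w₂] =
      (∏ j ∈ Finset.univ.filter (fun j : Fin n => (j : ℕ) < n - m),
        (a (Fin.castAdd 2 j) * z j) ^ N *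
            EllipticHyp.poch p q (w₁ / a (Fin.castAdd 2 j)) N *
            EllipticHyp.poch p q (w₂ / a (Fin.castAdd 2 j)) N /
          (EllipticHyp.poch p q (w₁ * z j) N * EllipticHyp.poch p q (w₂ * z j) N)) *
      EllipticHyp.ellSum p q N (EllipticHyp.xParam q N m z a w₁ w₂)
        (EllipticHyp.bParam q N m z a w₁ w₂) ![w₁, w₂] := by
  -- Without nodes nothing is swapped. For `n > 0`, the case `k = j` of admissibility gives `(q)_N ≠
  -- 0`, which the recursion needs.
  rcases Nat.eq_zero_or_pos n with rfl | hn
  · have hb : bParam q N m z a w₁ w₂ = a := by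
      funext j
      simp [bParam]
    rw [hb, Subsingleton.elim (xParam q N m z a w₁ w₂) z]
    simp
  have hW : w₁ * w₂ ≠ 0 := by
    rw [hbal]
    exact mul_ne_zero (prod_ne_zero_iff.2 fun j _ => hz j) (prod_ne_zero_iff.2 fun j _ => ha j)
  have hw₁ := left_ne_zero_of_mul hW
  have hw₂ := right_ne_zero_of_mul hW
  have hqN : ∀ i, 1 ≤ i → i ≤ N → theta p (q ^ i) ≠ 0 := by
    intro i h₁ h₂
    have h := hadm.2.2 ⟨0, hn⟩ ⟨0, hn⟩
    rw [mul_div_cancel_right₀ _ (hz _)] at h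
    have := prod_ne_zero_iff.1 h (i - 1) (mem_range.2 (by omega))
    rwa [← pow_succ', Nat.sub_add_cancel h₁] at this
  set T : ℕ := expSum n with hT
  have hTn : 2 * n + 3 ≤ T := two_mul_add_three_le_expSum n
  let zc : ℝ → Fin n → ℂ := fun t j => expCurve (z j) ((j : ℝ) + 1) t
  let ac : ℝ → Fin (n + 2) → ℂ := fun t j => expCurve (a j) ((j : ℝ) + 1) t
  -- The exponents of `w₁, w₂` are distinct half-integers with sum `T`, the total exponent of `z`
  -- and `a`, so the balancing holds for every `t`.
  let f : Fin 2 → ℝ := ![1 / 2, T - 1 / 2]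
  let w : Fin 2 → ℂ := ![w₁, w₂]
  let u₁ : ℝ → ℂ := expCurve w₁ (1 / 2)
  let u₂ : ℝ → ℂ := expCurve w₂ (T - 1 / 2)
  have hf : ∀ j, ∀ k : ℤ, f j + k ≠ 0 := by
    refine Fin.forall_fin_two.2 ⟨half_add_intCast_ne_zero, fun k => ?_⟩
    have := half_add_intCast_ne_zero (T - 1 + k)
    push_cast at this
    change (T : ℝ) - 1 / 2 + k ≠ 0
    convert! this using 1
    ring
  have hfinj : Function.Injective f := by
    have hne : (1 / 2 : ℝ) ≠ T - 1 / 2 := by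
      intro h
      have h₁ : (T : ℝ) = 1 := by linarith
      have h₂ : T = 1 := by exact_mod_cast h₁
      omega
    intro j k h
    fin_cases j <;> fin_cases k
    · rfl
    · exact absurd h hne
    · exact absurd h.symm hne
    · rfl
  have hw : ∀ j, w j ≠ 0 := Fin.forall_fin_two.2 ⟨hw₁, hw₂⟩
  have hwf : ∀ t, ![u₁ t, u₂ t] = fun j => expCurve (w j) (f j) t := by
    intro t
    funext j
    fin_cases j <;> rfl
  have hxne : ∀ j, xParam q N m z a w₁ w₂ j ≠ 0 := by
    intro j
    rw [xParam]
    split_ifs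
    · exact div_ne_zero (mul_ne_zero (zpow_ne_zero _ hq) (ha _)) hW
    · exact hz j
  have hx : ∀ t, xParam q N m (zc t) (ac t) (u₁ t) (u₂ t) =
      fun j => expCurve (xParam q N m z a w₁ w₂ j) (xExponent n m j : ℤ) t :=
    xParam_expCurve z a w₁ w₂ _ _ (by ring)
  have hbne : ∀ t j, bParam q N m (zc t) (ac t) (u₁ t) (u₂ t) j ≠ 0 := by
    intro t j
    rw [bParam]
    split_ifs
    · exact mul_ne_zero (mul_ne_zero (mul_ne_zero (zpow_ne_zero _ hq) (expCurve_ne_zero hw₁ _ _))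
        (expCurve_ne_zero hw₂ _ _)) (expCurve_ne_zero (hz _) _ _)
    · exact expCurve_ne_zero (ha _) _ _
  -- The last parameter is never swapped, so `b_i = a_i`, and the same distinguished index serves
  -- both sides.
  let i : Fin (n + 2) := Fin.natAdd n 1
  have hi : ((i : ℕ) : ℝ) = n + 1 := by simp [i]
  have hbalt : ∀ t, ∏ j, ![u₁ t, u₂ t] j = (∏ j, zc t j) * ∏ j, ac t j := by
    intro t
    rw [Fin.prod_univ_two]
    simp only [zc, ac, prod_expCurve]
    rw [expCurve_mul, ← hbal]
    change expCurve w₁ (1 / 2) t * expCurve w₂ (T - 1 / 2) t = _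
    rw [expCurve_mul]
    congr 1
    rw [hT, expSum]
    push_cast
    ring
  have hgen : ∀ᵐ t : ℝ, DualGeneric p q (zc t) (ac t) ![u₁ t, u₂ t] i := by
    have h₁ := ae_genericNodes (g := (i : ℝ) + 1) hp hq hz (ha i)
      (e := fun j : Fin n => (j : ℝ) + 1) (fun j k h => by
        simp only [add_left_inj, Nat.cast_inj] at h
        exact Fin.ext h) (fun k => by positivity)
    have h₂ := ae_genericNodes (g := -((i : ℝ) + 1)) hp hq hw (inv_ne_zero (ha i))
      (e := f) hfinj (fun k => by
        have := hf k (-(n + 2))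
        push_cast at this
        rw [hi]
        convert! this using 1
        ring)
    have h₃ := ae_cross hp hq hz hw (e := fun j : Fin n => (j : ℝ) + 1) (f := f)
      (fun j k => by exact_mod_cast hf j ((k : ℕ) + 1))
    filter_upwards [h₁, h₂, h₃] with t h₁ h₂ h₃
    refine ⟨rfl, h₁, ?_, fun j => expCurve_ne_zero (ha j) _ _, ?_, hbalt t⟩
    · rw [hwf, expCurve_inv]
      exact h₂
    · rw [hwf]
      exact h₃
  have hgen' : ∀ᵐ t : ℝ, DualGeneric p q (xParam q N m (zc t) (ac t) (u₁ t) (u₂ t))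
      (bParam q N m (zc t) (ac t) (u₁ t) (u₂ t)) ![u₁ t, u₂ t] i := by
    have h₁ := ae_genericNodes (g := (i : ℝ) + 1) hp hq hxne (ha i)
      (e := fun j : Fin n => ((xExponent n m j : ℤ) : ℝ))
      (fun j k h => xExponent_injective n m (Int.cast_injective h)) (fun k => by
        have : (((n : ℤ) + 2 + xExponent n m k : ℤ) : ℝ) ≠ 0 :=
          Int.cast_ne_zero.2 (add_xExponent_ne_zero n m k)
        push_cast at this
        rw [hi]
        convert! this using 1
        ring)
    have h₃ := ae_cross hp hq hxne hw (e := fun j : Fin n => ((xExponent n m j : ℤ) : ℝ))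
      (f := f) (fun j k => hf j _)
    filter_upwards [h₁, hgen, h₃] with t h₁ h₂ h₃
    have hbi : bParam q N m (zc t) (ac t) (u₁ t) (u₂ t) i = ac t i := bParam_natAdd _ _ _ _ 1
    refine ⟨rfl, ?_, ?_, hbne t, ?_, ?_⟩
    · rw [hx, hbi]
      exact h₁
    · rw [hbi]
      exact h₂.right
    · rw [hx, hwf]
      exact h₃
    · rw [prod_xParam_mul_prod_bParam hq _ _ (expCurve_ne_zero hw₁ _ _) (expCurve_ne_zero hw₂ _ _)]
      exact hbalt t
  have hz0 : zc 0 = z := funext fun j => expCurve_zero _ _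
  have ha0 : ac 0 = a := funext fun j => expCurve_zero _ _
  have hu₁ : u₁ 0 = w₁ := expCurve_zero _ _
  have hu₂ : u₂ 0 = w₂ := expCurve_zero _ _
  have hzc : ∀ j, ContinuousAt (fun t => zc t j) 0 := fun j => (continuous_expCurve _ _).continuousAt
  have hac : ∀ j, ContinuousAt (fun t => ac t j) 0 := fun j => (continuous_expCurve _ _).continuousAt
  have hc₁ : ContinuousAt u₁ 0 := (continuous_expCurve _ _).continuousAt
  have hc₂ : ContinuousAt u₂ 0 := (continuous_expCurve _ _).continuousAt
  have hwc : ∀ j, ContinuousAt (fun t => ![u₁ t, u₂ t] j) 0 := Fin.forall_fin_two.2 ⟨hc₁, hc₂⟩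
  have hw0 : ∀ j, ![u₁ 0, u₂ 0] j ≠ 0 := by
    rw [hu₁, hu₂]
    exact hw
  have hL : ContinuousAt (fun t => ellSum p q N (zc t) (ac t) ![u₁ t, u₂ t]) 0 := by
    refine continuousAt_ellSum hp hq hzc hac hwc ?_ ?_ hw0 ?_
    · rwa [hz0]
    · rwa [ha0]
    · rwa [hz0, hu₁, hu₂]
  have hR : ContinuousAt (fun t => ellSum p q N (xParam q N m (zc t) (ac t) (u₁ t) (u₂ t))
      (bParam q N m (zc t) (ac t) (u₁ t) (u₂ t)) ![u₁ t, u₂ t]) 0 := by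
    refine continuousAt_ellSum hp hq (fun j => ?_) (fun j => ?_) hwc ?_ (hbne 0) hw0 ?_
    · simp only [hx]
      exact (continuous_expCurve _ _).continuousAt
    · simp only [bParam]
      split_ifs
      · exact ((continuousAt_const.mul hc₁).mul hc₂).mul (hzc _)
      · exact hac j
    · rwa [hz0, ha0, hu₁, hu₂]
    · rwa [hz0, ha0, hu₁, hu₂]
  have hP : ContinuousAt (fun t => ∏ j ∈ univ.filter (fun j : Fin n => (j : ℕ) < n - m),
      (ac t (Fin.castAdd 2 j) * zc t j) ^ N * poch p q (u₁ t / ac t (Fin.castAdd 2 j)) N *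
        poch p q (u₂ t / ac t (Fin.castAdd 2 j)) N /
          (poch p q (u₁ t * zc t j) N * poch p q (u₂ t * zc t j) N)) 0 := by
    refine tendsto_finsetProd _ fun j _ => ?_
    have hzj : zc 0 j ≠ 0 := hz0 ▸ hz j
    have haj : ac 0 (Fin.castAdd 2 j) ≠ 0 := ha0 ▸ ha _
    have hv₁ : u₁ 0 ≠ 0 := hw0 0
    have hv₂ : u₂ 0 ≠ 0 := hw0 1
    refine ContinuousAt.div (((((hac _).mul (hzc j)).pow N).mul
      (continuousAt_poch hp hq (hc₁.div (hac _) haj) (div_ne_zero hv₁ haj) N)).mul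
      (continuousAt_poch hp hq (hc₂.div (hac _) haj) (div_ne_zero hv₂ haj) N))
      ((continuousAt_poch hp hq (hc₁.mul (hzc j)) (mul_ne_zero hv₁ hzj) N).mul
      (continuousAt_poch hp hq (hc₂.mul (hzc j)) (mul_ne_zero hv₂ hzj) N)) ?_
    rw [hz0, hu₁, hu₂]
    exact mul_ne_zero (hadm.2.1 j 0) (hadm.2.1 j 1)
  have key := eq_of_ae_eq_of_continuousAt hL (hP.mul hR) (by
    filter_upwards [hgen, hgen'] with t h h'
    exact ellSum_swap_of_generic hp hq hqN h h')
  simpa only [Pi.mul_apply, hz0, ha0, hu₁, hu₂] using key
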